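/- Let $S,A$ be Polish spaces, $P\in\mathcal P(S|S\times A)$ a transition kernel, $c:S\times A\to\mathbb R$ a bounded measurable cost, $\gamma\in(0,1)$, $\mu\in\mathcal P(A)$ and $\tau>0$. For a policy $\pi\in\mathcal P(A|S)$ and $\rho\in\mathcal P(S)$ put $$V^\pi_\tau(s)=\mathbb E^\pi_s\Big[\sum_{n\ge0}\gamma^n\big(c(s_n,a_n)+\tau\,\mathrm{KL}(\pi(\cdot|s_n)|\mu)\big)\Big]\in\mathbb R\cup\{+\infty\},\qquad V^\pi_\tau(\rho)=\int_S V^\pi_\tau(s)\,\rho(ds),$$ and call $\pi^*\in\mathcal P(A|S)$ optimal for $\rho$ if $V^{\pi^*}_\tau(\rho)=\inf_{\pi\in\mathcal P(A|S)}V^\pi_\tau(\rho)$. Let $\Pi_\mu$ be the set of policies of the form $\pi(da|s)=e^{f(s,a)}\mu(da)/\int_A e^{f(s,a')}\mu(da')$ with $f$ bounded and measurable. For $\pi\in\Pi_\mu$ let $Q^\pi_\tau(s,a)=c(s,a)+\gamma\int_S V^\pi_\tau(s')P(ds'|s,a)$, let $P_\pi(ds'|s)=\int_A P(ds'|s,a)\pi(da|s)$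 and $P^\pi(ds',da'|s,a)=P(ds'|s,a)\pi(da'|s')$, and for $\nu\in\mathcal P(S)$, $\beta\in\mathcal P(S\times A)$ let $$d^\pi_\nu=(1-\gamma)\sum_{n\ge0}\gamma^n\,\nu P_\pi^n,\qquad d^\pi_\beta=(1-\gamma)\sum_{n\ge0}\gamma^n\,\beta(P^\pi)^n .$$ Let $$T^\pi_\tau f(s,a)=c(s,a)+\gamma\int f\,dP^\pi(\cdot|s,a)+\tau\gamma\int_S\mathrm{KL}(\pi(\cdot|s')|\mu)\,P(ds'|s,a).$$ Let $\phi:S\times A\to\mathbb R^N$ be measurable, $Q(s,a;\theta)=\langle\theta,\phi(s,a)\rangle$, and fix $\beta\in\mathcal P(S\times A)$. Define $$g(\theta,\pi)=\int\big(Q(s,a;\theta)-T^\pi_\tau Q(\cdot;\theta)(s,a)\big)\phi(s,a)\,d^\pi_\beta(ds,da),$$ $$A(s,a;\theta,\pi)=Q(s,a;\theta)+\tau\ln\tfrac{d\pi}{d\mu}(s,a)-\int_A\Big(Q(s,a';\theta)+\tau\ln\tfrac{d\pi}{d\mu}(s,a')\Big)\pi(da'|s),$$ and, for $\lambda>0$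 and $\nu\in\mathcal P(S)$, $$\tilde G_\nu(\pi,\pi',\theta)=\int_S\Big(\int_A A(s,a;\theta,\pi')\,\pi(da|s)+\tfrac1\lambda\mathrm{KL}(\pi(\cdot|s)|\pi'(\cdot|s))\Big)d^{\pi'}_\nu(ds).$$ Assume: (realisability) for every $\pi\in\Pi_\mu$ there is $\theta_\pi\in\mathbb R^N$ with $Q^\pi_\tau(s,a)=\langle\theta_\pi,\phi(s,a)\rangle$ for all $(s,a)$; (eigenvalue condition) $\lambda_\beta:=\lambda_{\min}\big(\int\phi\phi^\top d\beta\big)>0$; (bounded features) $|\phi(s,a)|_2\le1$ for all $(s,a)$. Let $\Gamma=(1-\gamma)(1-\sqrt\gamma)\lambda_\beta$, $0<h<\frac{\Gamma}{2(1+\gamma)}$, $\lambda>0$ with $\tau\lambda<1$, and $\kappa>0$. Let $M(n)\in\mathbb N$ satisfy $M(n)\ge\frac{4}{h\Gamma}\log(\kappa(n+1))$ for all $n\ge0$. Let $(\theta^n,\pi^n)_{n\ge0}$ be iterates of the double loop actor-critic algorithm: $\theta^0\in\mathbb R^N$ and $\pi^0\in\Pi_\mu$ are arbitrary, and for $n\ge0$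 $$\theta^{n,0}=\theta^n,\qquad \theta^{n,k}=\theta^{n,k-1}-h\,g(\theta^{n,k-1},\pi^n)\ (1\le k\le M(n)),\qquad \theta^{n+1}=\theta^{n,M(n)},$$ $$\pi^{n+1}\in\operatorname*{arg\,min}_{\pi\in\Pi_\mu}\tilde G_\nu(\pi,\pi^n,\theta^{n+1})\quad\text{for every }\nu\in\mathcal P(S)$$ (that is, the integrand in $\tilde G$ is minimised at every state $s$). Then there exists $a\ge0$ such that for every $\rho\in\mathcal P(S)$ an optimal policy for $\rho$ exists, and for every policy $\pi^*$ optimal for $\rho$ and all integers $n\ge1$, $$\min_{0\le r\le n-1}V^{\pi^r}_\tau(\rho)-V^{\pi^*}_\tau(\rho)\le\frac an .$$ -/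

import Mathlib

open MeasureTheory ProbabilityTheory
open scoped ENNReal

noncomputable section

/-- An entropy-regularised Markov decision process with transition kernel `P`, bounded measurable
cost, discount factor `γ ∈ (0,1)`, reference probability measure `μ` on the actions and
regularisation parameter `τ > 0`. -/
structure EntropyMDP (S A : Type*) [MeasurableSpace S] [MeasurableSpace A] where
  P : Kernel (S × A) S
  markov_P : IsMarkovKernel P
  cost : S × A → ℝ
  measurable_cost : Measurable cost
  bounded_cost : ∃ B : ℝ, ∀ p, |cost p| ≤ B
  γ : ℝ
  γ_pos : 0 < γ
  γ_lt_one : γ < 1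
  μ : Measure A
  prob_μ : IsProbabilityMeasure μ
  τ : ℝ
  τ_pos : 0 < τ

attribute [instance] EntropyMDP.markov_P EntropyMDP.prob_μ

namespace EntropyMDP

variable {S A : Type*} [MeasurableSpace S] [MeasurableSpace A] (M : EntropyMDP S A)

/-- The state transition kernel `P_π(ds'|s) = ∫ P(ds'|s,a) π(da|s)` of a policy. -/
def stateKernel (π : Kernel S A) : Kernel S S := M.P ∘ₖ (Kernel.id ×ₖ π)

/-- The state-action transition kernel `P^π(ds',da'|s,a) = P(ds'|s,a) π(da'|s')`. -/
def stateActionKernel (π : Kernel S A) : Kernel (S × A) (S × A) :=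
  M.P ⊗ₖ Kernel.prodMkLeft (S × A) π

/-- The discounted expected cost `E_s^π[∑ₙ γⁿ c(sₙ,aₙ)]`. Here `sₙ` has law `P_π^n(·|s)`, the power
being that of the monoid of kernels under composition, and `aₙ` has conditional law `π(·|sₙ)`. -/
def costPart (π : Kernel S A) (s : S) : ℝ :=
  ∑' n : ℕ, M.γ ^ n * ∫ s', (∫ a, M.cost (s', a) ∂(π s')) ∂((M.stateKernel π ^ n) s)

/-- The discounted expected regularisation `E_s^π[∑ₙ γⁿ τ KL(π(·|sₙ)|μ)]`, possibly infinite. -/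
def klPart (π : Kernel S A) (s : S) : ℝ≥0∞ :=
  ∑' n : ℕ, ENNReal.ofReal (M.γ ^ n * M.τ) *
    ∫⁻ s', InformationTheory.klDiv (π s') M.μ ∂((M.stateKernel π ^ n) s)

/-- The regularised value function `V^π_τ(s) ∈ ℝ ∪ {+∞}`. -/
def value (π : Kernel S A) (s : S) : EReal :=
  (M.costPart π s : EReal) + (M.klPart π s : EReal)

/-- `V^π_τ(ρ) = ∫ V^π_τ(s) ρ(ds) ∈ ℝ ∪ {+∞}`: the integral of the sum of the bounded cost part and
of the nonnegative extended-valued regularisation part. -/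
def valueAt (π : Kernel S A) (ρ : Measure S) : EReal :=
  ((∫ s, M.costPart π s ∂ρ : ℝ) : EReal) + ((∫⁻ s, M.klPart π s ∂ρ : ℝ≥0∞) : EReal)

/-- `V*_τ(ρ)`, the infimum of `V^π_τ(ρ)` over all policies `π ∈ 𝒫(A|S)`. -/
def optimalValue (ρ : Measure S) : EReal :=
  ⨅ (π : Kernel S A) (_ : IsMarkovKernel π), M.valueAt π ρ

/-- `π ∈ 𝒫(A|S)` is an optimal policy for the initial distribution `ρ`. -/
def IsOptimalPolicy (ρ : Measure S) (π : Kernel S A) : Prop :=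
  IsMarkovKernel π ∧ M.valueAt π ρ = M.optimalValue ρ

/-- The class `Π_μ` of admissible policies: `π(da|s) = exp(f(s,a)) μ(da) / ∫ exp(f(s,·)) dμ` for
some bounded measurable `f`. -/
def IsAdmissible (π : Kernel S A) : Prop :=
  IsMarkovKernel π ∧ ∃ f : S × A → ℝ, Measurable f ∧ (∃ B : ℝ, ∀ p, |f p| ≤ B) ∧
    ∀ s, π s = M.μ.tilted (fun a => f (s, a))

/-- The state-action value function `Q^π_τ` of an admissible policy (whose value is finite). -/
def qValue (π : Kernel S A) (p : S × A) : ℝ :=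
  M.cost p + M.γ * ∫ s', (M.value π s').toReal ∂(M.P p)

/-- The Bellman operator `T^π_τ`. -/
def bellman (π : Kernel S A) (f : S × A → ℝ) (p : S × A) : ℝ :=
  M.cost p + M.γ * (∫ q, f q ∂(M.stateActionKernel π p))
    + M.τ * M.γ * ∫ s', (InformationTheory.klDiv (π s') M.μ).toReal ∂(M.P p)

/-- The state occupancy measure `d^π_ρ = (1-γ) ∑ₙ γⁿ ρ P_π^n`. -/
def stateOccupancy (π : Kernel S A) (ρ : Measure S) : Measure S :=
  Measure.sum fun n : ℕ =>
    ENNReal.ofReal ((1 - M.γ) * M.γ ^ n) • ρ.bind (M.stateKernel π ^ n)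

/-- The state-action occupancy measure `d^π_β = (1-γ) ∑ₙ γⁿ β (P^π)^n`. -/
def stateActionOccupancy (π : Kernel S A) (β : Measure (S × A)) : Measure (S × A) :=
  Measure.sum fun n : ℕ =>
    ENNReal.ofReal ((1 - M.γ) * M.γ ^ n) • β.bind (M.stateActionKernel π ^ n)

variable {N : ℕ} (φ : S × A → EuclideanSpace ℝ (Fin N))

/-- The linear parametrisation `Q(s,a;θ) = ⟨θ, φ(s,a)⟩`. -/
def linQ (θ : EuclideanSpace ℝ (Fin N)) (p : S × A) : ℝ := inner ℝ θ (φ p)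

/-- The approximate soft advantage function
`A(s,a;θ,π) = Q(s,a;θ) + τ ln (dπ/dμ)(s,a) - ∫ (Q(s,a';θ) + τ ln (dπ/dμ)(s,a')) π(da'|s)`. -/
def approxAdvantage (θ : EuclideanSpace ℝ (Fin N)) (π : Kernel S A) (s : S) (a : A) : ℝ :=
  linQ φ θ (s, a) + M.τ * llr (π s) M.μ a
    - ∫ a', (linQ φ θ (s, a') + M.τ * llr (π s) M.μ a') ∂(π s)

/-- The semi-gradient of the mean squared Bellman error,
`g(θ,π) = ∫ (Q(s,a;θ) - T^π_τ Q(·;θ)(s,a)) φ(s,a) d^π_β(ds,da)`. -/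
def semiGradient (β : Measure (S × A)) (θ : EuclideanSpace ℝ (Fin N)) (π : Kernel S A) :
    EuclideanSpace ℝ (Fin N) :=
  ∫ p, (linQ φ θ p - M.bellman π (linQ φ θ) p) • φ p ∂(M.stateActionOccupancy π β)

/-- The approximate mirror descent objective with initial distribution `ν`,
`G̃_ν(π,π',θ) = ∫ (∫ A(s,a;θ,π') π(da|s) + (1/lam) KL(π(·|s)|π'(·|s))) d^{π'}_ν(ds)`. -/
def mirrorObjective (lam : ℝ) (ν : Measure S) (π π' : Kernel S A)
    (θ : EuclideanSpace ℝ (Fin N)) : ℝ :=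
  ∫ s, ((∫ a, M.approxAdvantage φ θ π' s a ∂(π s))
    + 1 / lam * (InformationTheory.klDiv (π s) (π' s)).toReal) ∂(M.stateOccupancy π' ν)

/-- `πnew` is the minimiser over `Π_μ` of `G̃_ν(·,π,θ)`, simultaneously for all initial
distributions `ν`. For a single `ν` the objective determines `πnew(·|s)` only up to a null set of
states `s`; asking for all `ν` at once selects the policy that minimises the integrand at
every `s`. -/
def IsMirrorStep (lam : ℝ) (θ : EuclideanSpace ℝ (Fin N)) (π πnew : Kernel S A) : Prop :=
  M.IsAdmissible πnew ∧ ∀ ν : Measure S, IsProbabilityMeasure ν →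
    ∀ π' : Kernel S A, M.IsAdmissible π' →
      M.mirrorObjective φ lam ν πnew π θ ≤ M.mirrorObjective φ lam ν π' π θ

/-- `(θ n, π n)` are iterates of the double loop actor-critic algorithm with critic step size `h`,
actor step size `lam` and `K n` inner temporal difference steps at the `n`-th policy, started at an
arbitrary `θ 0` and an arbitrary `π 0 ∈ Π_μ`. -/
structure IsDoubleLoop (β : Measure (S × A)) (h lam : ℝ) (K : ℕ → ℕ)
    (θ : ℕ → EuclideanSpace ℝ (Fin N)) (π : ℕ → Kernel S A) : Prop where
  initial : M.IsAdmissible (π 0)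
  critic : ∀ n, θ (n + 1) = (fun ϑ => ϑ - h • M.semiGradient φ β ϑ (π n))^[K n] (θ n)
  actor : ∀ n, M.IsMirrorStep φ lam (θ (n + 1)) (π n) (π (n + 1))

/-- `Q^π_τ`-realisability. -/
def Realisable : Prop :=
  ∀ π : Kernel S A, M.IsAdmissible π →
    ∃ θ : EuclideanSpace ℝ (Fin N), ∀ p, M.qValue π p = linQ φ θ p

/-- The feature covariance matrix `∫ φ(s,a) φ(s,a)ᵀ β(ds,da)`. -/
def featureCov (β : Measure (S × A)) : Matrix (Fin N) (Fin N) ℝ :=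
  Matrix.of fun i j => ∫ p, φ p i * φ p j ∂β

/-- `λ_β`, the minimum eigenvalue of the feature covariance matrix. -/
def minEigenvalue (β : Measure (S × A)) : ℝ := sInf (spectrum ℝ (featureCov φ β))

/-- `Γ = (1-γ)(1-√γ) λ_β`. -/
def Gam (β : Measure (S × A)) : ℝ := (1 - M.γ) * (1 - √M.γ) * minEigenvalue φ β

end EntropyMDP

end

/-! Every admissible policy has a bounded normalised log-density `l` with respect to `μ`, and at
every state the mirror step is the Gibbs update `l' = (1 - τ lam) l - lam q - lam z(s)`, where `q`
is the critic's estimate of `Q^π` (`isLogDensity_mirrorStep`). With sup-error `e` in `q`,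
nonnegativity of KL gives two facts. The value rises by at most `2e/(1-γ)`
(`realValue_mirrorStep_le`). Against any comparison law `ν` of finite entropy, the one-step
suboptimality is at most a difference of successive values, plus `1/lam` times the change of `∫ l
dν`, plus an error (`realValue_sub_le_of_mirrorStep`).

Integrating the second fact over the occupancy measure of an optimal policy turns the left side into
`1 - γ` times the optimality gap, by the performance difference identity (`exists_valueAt_eq`), and
the right side telescopes. Values are uniformly bounded below, and `∫ l dν ≤ KL(ν|μ)` caps the last
log-density term. Hence the total regret stays bounded once the critic errors are summable, and the
smallest gap is at most the average one.

Summability looks circular: the error `e n` is a small factor times the distance from the warm start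
to the new target `θ_π`, whose size depends on the values, which may grow with earlier errors.
Temporal difference learning is strongly monotone, so the inner loop contracts by a factor of order
`(n+1)⁻²`. The eigenvalue condition bounds `θ_π` by the sup norm of `Q^π`, hence by an affine
function of `∑_{i<n} e i`. A discrete Grönwall inequality closes the loop
(`exists_sum_norm_sub_le`).

An optimal policy exists as the Gibbs policy of the soft Bellman fixed point
(`exists_isOptimalPolicy`). -/

/-- Bounded measurable real functions. -/
def IsBddMeas {X : Type*} [MeasurableSpace X] (f : X → ℝ) : Prop :=
  Measurable f ∧ ∃ B : ℝ, ∀ x, |f x| ≤ B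

/-! ### Bounded measurable functions and contraction fixed points. -/

namespace IsBddMeas

variable {X Y : Type*} [MeasurableSpace X] [MeasurableSpace Y] {f g : X → ℝ}

theorem const (c : ℝ) : IsBddMeas (fun _ : X => c) := ⟨measurable_const, |c|, fun _ => le_rfl⟩

theorem add (hf : IsBddMeas f) (hg : IsBddMeas g) : IsBddMeas (fun x => f x + g x) := by
  obtain ⟨hf, B, hB⟩ := hf
  obtain ⟨hg, C, hC⟩ := hg
  exact ⟨hf.add hg, B + C, fun x => (abs_add_le _ _).trans (add_le_add (hB x) (hC x))⟩

theorem mul (hf : IsBddMeas f) (hg : IsBddMeas g) : IsBddMeas (fun x => f x * g x) := by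
  obtain ⟨hf, B, hB⟩ := hf
  obtain ⟨hg, C, hC⟩ := hg
  refine ⟨hf.mul hg, B * C, fun x => ?_⟩
  rw [abs_mul]
  exact mul_le_mul (hB x) (hC x) (abs_nonneg _) ((abs_nonneg _).trans (hB x))

theorem const_mul (c : ℝ) (hf : IsBddMeas f) : IsBddMeas (fun x => c * f x) := (const c).mul hf

theorem neg (hf : IsBddMeas f) : IsBddMeas (fun x => -f x) := by
  simpa using hf.const_mul (-1)

theorem sub (hf : IsBddMeas f) (hg : IsBddMeas g) : IsBddMeas (fun x => f x - g x) := by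
  simpa [sub_eq_add_neg] using hf.add hg.neg

theorem comp (hf : IsBddMeas f) {u : Y → X} (hu : Measurable u) : IsBddMeas (fun y => f (u y)) :=
  ⟨hf.1.comp hu, hf.2.choose, fun y => hf.2.choose_spec (u y)⟩

theorem integrable (hf : IsBddMeas f) (ν : Measure X) [IsFiniteMeasure ν] : Integrable f ν := by
  obtain ⟨hf, B, hB⟩ := hf
  exact Integrable.of_bound hf.aestronglyMeasurable B (ae_of_all _ hB)

theorem exp (hf : IsBddMeas f) : IsBddMeas (fun x => Real.exp (f x)) := by
  obtain ⟨hf, B, hB⟩ := hf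
  refine ⟨hf.exp, Real.exp B, fun x => ?_⟩
  rw [abs_of_pos (Real.exp_pos _)]
  exact Real.exp_le_exp.2 ((le_abs_self _).trans (hB x))

theorem abs_integral_le {B : ℝ} (hB : ∀ x, |f x| ≤ B) (ν : Measure X) [IsProbabilityMeasure ν] :
    |∫ x, f x ∂ν| ≤ B := by
  simpa using norm_integral_le_of_norm_le_const (μ := ν) (f := f) (C := B) (ae_of_all _ hB)

theorem integral_kernel (hf : IsBddMeas f) (κ : Kernel Y X) [IsMarkovKernel κ] :
    IsBddMeas (fun y => ∫ x, f x ∂(κ y)) := by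
  obtain ⟨hf, B, hB⟩ := hf
  exact ⟨(hf.stronglyMeasurable.integral_kernel (κ := κ)).measurable, B,
    fun y => abs_integral_le hB _⟩

theorem integral_kernel_prod {f : Y × X → ℝ} (hf : IsBddMeas f) (κ : Kernel Y X)
    [IsMarkovKernel κ] : IsBddMeas (fun y => ∫ x, f (y, x) ∂(κ y)) := by
  obtain ⟨hf, B, hB⟩ := hf
  exact ⟨(hf.stronglyMeasurable.integral_kernel_prod_right' (κ := κ)).measurable, B,
    fun y => abs_integral_le (fun x => hB (y, x)) _⟩

theorem integral_prod {f : Y × X → ℝ} (hf : IsBddMeas f) (ν : Measure X)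
    [IsProbabilityMeasure ν] : IsBddMeas (fun y => ∫ x, f (y, x) ∂ν) :=
  hf.integral_kernel_prod (Kernel.const Y ν)

/-- A contraction for the supremum distance that preserves bounded measurable functions has a
bounded measurable fixed point. -/
theorem exists_fixedPoint {γ : ℝ} (hγ0 : 0 < γ) (hγ : γ < 1) (T : (X → ℝ) → X → ℝ)
    (hT : ∀ f, IsBddMeas f → IsBddMeas (T f))
    (hc : ∀ f g C, IsBddMeas f → IsBddMeas g → (∀ x, |f x - g x| ≤ C) →
      ∀ x, |T f x - T g x| ≤ γ * C) :
    ∃ f, IsBddMeas f ∧ T f = f := by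
  set u : ℕ → X → ℝ := fun n => T^[n] 0 with hu
  have hus : ∀ n, u (n + 1) = T (u n) := fun n => Function.iterate_succ_apply' T n 0
  have hub : ∀ n, IsBddMeas (u n) := by
    intro n
    induction n with
    | zero => exact const 0
    | succ n ih => rw [hus]; exact hT _ ih
  obtain ⟨C, hC⟩ := ((hub 0).sub (hub 1)).2
  have hd : ∀ x n, dist (u n x) (u (n + 1) x) ≤ C * γ ^ n := by
    intro x n
    induction n generalizing x with
    | zero => simpa [Real.dist_eq] using hC x
    | succ n ih =>
      rw [hus (n + 1), hus n, ← hus n, Real.dist_eq]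
      have := hc (u n) (u (n + 1)) (C * γ ^ n) (hub n) (hub (n + 1))
        (fun x => by simpa [Real.dist_eq] using ih x) x
      rw [hus n] at this ⊢
      calc _ ≤ _ := this
        _ = _ := by ring
  have hlim : ∀ x, ∃ y, Filter.Tendsto (fun n => u n x) Filter.atTop (nhds y) := fun x =>
    cauchySeq_tendsto_of_complete (cauchySeq_of_le_geometric γ C hγ (hd x))
  choose f hf using hlim
  have hfd : ∀ n x, |u n x - f x| ≤ C * γ ^ n / (1 - γ) := fun n x => by
    simpa [Real.dist_eq] using dist_le_of_le_geometric_of_tendsto γ C hγ (hd x) (hf x) n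
  have hfm : Measurable f := measurable_of_tendsto_metrizable (fun n => (hub n).1)
    (tendsto_pi_nhds.2 hf)
  have hfb : IsBddMeas f := by
    refine ⟨hfm, C / (1 - γ), fun x => ?_⟩
    have := hfd 0 x
    simpa [hu] using this
  refine ⟨f, hfb, ?_⟩
  funext x
  -- The shifted iterates `T (u n)` tend to `f`, and also to `T f` because the error `hfd` is
  -- uniform in the point.
  refine tendsto_nhds_unique (f := fun n => u (n + 1) x) ?_
    ((Filter.tendsto_add_atTop_iff_nat 1).2 (hf x))
  rw [tendsto_iff_dist_tendsto_zero]
  refine squeeze_zero (fun _ => dist_nonneg) (g := fun n => γ * (C * γ ^ n / (1 - γ))) ?_ ?_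
  · intro n
    rw [hus, Real.dist_eq]
    exact hc _ _ _ (hub n) hfb (hfd n) x
  · have := (tendsto_pow_atTop_nhds_zero_of_lt_one hγ0.le hγ).const_mul (γ * (C / (1 - γ)))
    rw [mul_zero] at this
    refine this.congr fun n => ?_
    ring

/-- Policy evaluation: averaging by a Markov kernel does not increase the sup norm, so the affine
map is a `γ`-contraction. -/
theorem exists_eq_add_mul_integral {κ : Kernel X X} [IsMarkovKernel κ] {u : X → ℝ}
    (hu : IsBddMeas u) {γ : ℝ} (h0 : 0 < γ) (h1 : γ < 1) :
    ∃ W, IsBddMeas W ∧ ∀ s, W s = u s + γ * ∫ s', W s' ∂(κ s) := by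
  obtain ⟨W, hW, hT⟩ := exists_fixedPoint h0 h1
    (fun W s => u s + γ * ∫ s', W s' ∂(κ s))
    (fun W hW => hu.add ((hW.integral_kernel κ).const_mul γ)) (by
      intro f g C hf hg hC s
      have : u s + γ * ∫ s', f s' ∂(κ s) - (u s + γ * ∫ s', g s' ∂(κ s)) =
          γ * ∫ s', (f s' - g s') ∂(κ s) := by
        rw [integral_sub (hf.integrable _) (hg.integrable _)]
        ring
      rw [this, abs_mul, abs_of_pos h0]
      exact mul_le_mul_of_nonneg_left (abs_integral_le hC _) h0.le)
  exact ⟨W, hW, fun s => (congrFun hT s).symm⟩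

end IsBddMeas

/-! ### Discounted occupancy measures. -/

section Occupancy

variable {X : Type*} [MeasurableSpace X]

instance isMarkovKernel_pow (κ : Kernel X X) [IsMarkovKernel κ] (n : ℕ) :
    IsMarkovKernel (κ ^ n) := by
  induction n with
  | zero => rw [pow_zero]; exact inferInstanceAs (IsMarkovKernel Kernel.id)
  | succ n ih => rw [pow_succ]; exact inferInstanceAs (IsMarkovKernel ((κ ^ n) ∘ₖ κ))

/-- The discounted occupancy measure of a Markov chain. -/
noncomputable def occupancy (γ : ℝ) (κ : Kernel X X) (ν : Measure X) : Measure X :=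
  Measure.sum fun n : ℕ => ENNReal.ofReal ((1 - γ) * γ ^ n) • ν.bind (κ ^ n)

theorem lintegral_occupancy (γ : ℝ) (κ : Kernel X X) (ν : Measure X) {f : X → ℝ≥0∞}
    (hf : Measurable f) :
    ∫⁻ x, f x ∂(occupancy γ κ ν) =
      ∑' n, ENNReal.ofReal ((1 - γ) * γ ^ n) * ∫⁻ x, ∫⁻ y, f y ∂((κ ^ n) x) ∂ν := by
  rw [occupancy, lintegral_sum_measure]
  refine tsum_congr fun n => ?_
  rw [lintegral_smul_measure, Measure.lintegral_bind (Kernel.aemeasurable _) hf.aemeasurable,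
    smul_eq_mul]

theorem hasSum_discount {γ : ℝ} (h0 : 0 < γ) (h1 : γ < 1) :
    HasSum (fun n : ℕ => (1 - γ) * γ ^ n) 1 := by
  have := (hasSum_geometric_of_lt_one h0.le h1).mul_left (1 - γ)
  rwa [mul_inv_cancel₀ (by linarith)] at this

theorem isProbabilityMeasure_bind (κ : Kernel X X) [IsMarkovKernel κ] (ν : Measure X)
    [IsProbabilityMeasure ν] : IsProbabilityMeasure (ν.bind κ) := by
  constructor
  rw [Measure.bind_apply MeasurableSet.univ (Kernel.aemeasurable _)]
  simp

theorem isProbabilityMeasure_occupancy {γ : ℝ} (h0 : 0 < γ) (h1 : γ < 1) (κ : Kernel X X)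
    [IsMarkovKernel κ] (ν : Measure X) [IsProbabilityMeasure ν] :
    IsProbabilityMeasure (occupancy γ κ ν) := by
  constructor
  have h := lintegral_occupancy γ κ ν (f := fun _ => 1) measurable_const
  simp only [lintegral_one, measure_univ, mul_one] at h
  rw [h, ← ENNReal.ofReal_tsum_of_nonneg (fun n => by have : 0 < 1 - γ := by linarith
                                                      positivity) (hasSum_discount h0 h1).summable,
    (hasSum_discount h0 h1).tsum_eq, ENNReal.ofReal_one]

/-- The flow equation: split off the term `n = 0` of the series and shift the rest by one
transition. -/
theorem occupancy_eq {γ : ℝ} (h0 : 0 < γ) (κ : Kernel X X) (ν : Measure X) :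
    occupancy γ κ ν =
      ENNReal.ofReal (1 - γ) • ν + ENNReal.ofReal γ • (occupancy γ κ ν).bind κ := by
  refine Measure.ext_of_lintegral _ fun f hf => ?_
  have hκ : Measurable fun x => ∫⁻ y, f y ∂(κ x) := hf.lintegral_kernel
  rw [lintegral_add_measure, lintegral_smul_measure, lintegral_smul_measure,
    Measure.lintegral_bind (Kernel.aemeasurable _) hf.aemeasurable, lintegral_occupancy _ _ _ hf,
    lintegral_occupancy _ _ _ hκ, tsum_eq_zero_add' ENNReal.summable, smul_eq_mul, smul_eq_mul,
    ← ENNReal.tsum_mul_left]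
  congr 1
  · simp only [pow_zero, mul_one]
    congr 1
    refine lintegral_congr fun x => ?_
    change ∫⁻ y, f y ∂(Kernel.id x) = f x
    rw [Kernel.id_apply, lintegral_dirac' _ hf]
  · refine tsum_congr fun n => ?_
    rw [← mul_assoc, ← ENNReal.ofReal_mul h0.le]
    congr 1
    · congr 1; ring
    · refine lintegral_congr fun x => ?_
      rw [pow_succ']
      change ∫⁻ y, f y ∂((κ ∘ₖ (κ ^ n)) x) = _
      rw [Kernel.lintegral_comp _ _ _ hf]

theorem integral_bind_kernel {Y : Type*} [MeasurableSpace Y] {f : Y → ℝ} (hf : IsBddMeas f)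
    (κ : Kernel X Y) [IsMarkovKernel κ] (ν : Measure X) [IsProbabilityMeasure ν] :
    ∫ x, f x ∂(ν.bind κ) = ∫ x, ∫ y, f y ∂(κ x) ∂ν := by
  have h : ν.bind κ = (κ ∘ₖ Kernel.const Unit ν) () := by simp
  rw [h, Kernel.integral_comp (hf.integrable _)]
  simp

theorem integral_occupancy_eq {γ : ℝ} (h0 : 0 < γ) (h1 : γ < 1) (κ : Kernel X X)
    [IsMarkovKernel κ] (ν : Measure X) [IsProbabilityMeasure ν] {f : X → ℝ} (hf : IsBddMeas f) :
    ∫ x, f x ∂(occupancy γ κ ν) =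
      (1 - γ) * ∫ x, f x ∂ν + γ * ∫ x, ∫ y, f y ∂(κ x) ∂(occupancy γ κ ν) := by
  have := isProbabilityMeasure_occupancy h0 h1 κ ν
  have := isProbabilityMeasure_bind κ (occupancy γ κ ν)
  conv_lhs => rw [occupancy_eq h0]
  rw [integral_add_measure, integral_smul_measure, integral_smul_measure,
    integral_bind_kernel hf, ENNReal.toReal_ofReal (by linarith), ENNReal.toReal_ofReal h0.le,
    smul_eq_mul, smul_eq_mul]
  · exact (hf.integrable _).smul_measure ENNReal.ofReal_ne_top
  · exact (hf.integrable _).smul_measure ENNReal.ofReal_ne_top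

theorem integral_occupancy {γ : ℝ} (h0 : 0 < γ) (h1 : γ < 1) (κ : Kernel X X)
    [IsMarkovKernel κ] (ν : Measure X) [IsProbabilityMeasure ν] {f : X → ℝ} (hf : IsBddMeas f) :
    ∫ x, f x ∂(occupancy γ κ ν) =
      ∑' n, (1 - γ) * γ ^ n * ∫ x, ∫ y, f y ∂((κ ^ n) x) ∂ν := by
  have := isProbabilityMeasure_occupancy h0 h1 κ ν
  rw [occupancy, integral_sum_measure (hf.integrable (occupancy γ κ ν))]
  refine tsum_congr fun n => ?_
  have : 0 < 1 - γ := by linarith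
  rw [integral_smul_measure, integral_bind_kernel hf, ENNReal.toReal_ofReal (by positivity),
    smul_eq_mul]

/-- Drop the nonnegative successor term of the flow equation; the next lemma drops the initial term
instead. -/
theorem mul_integral_le_integral_occupancy {γ : ℝ} (h0 : 0 < γ) (h1 : γ < 1) (κ : Kernel X X)
    [IsMarkovKernel κ] (ν : Measure X) [IsProbabilityMeasure ν] {f : X → ℝ} (hf : IsBddMeas f)
    (hf0 : ∀ x, 0 ≤ f x) : (1 - γ) * ∫ x, f x ∂ν ≤ ∫ x, f x ∂(occupancy γ κ ν) := by
  rw [integral_occupancy_eq h0 h1 κ ν hf]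
  have : 0 ≤ ∫ x, ∫ y, f y ∂(κ x) ∂(occupancy γ κ ν) :=
    integral_nonneg fun x => integral_nonneg hf0
  have := mul_nonneg h0.le this
  linarith

theorem mul_integral_comp_le_integral_occupancy {γ : ℝ} (h0 : 0 < γ) (h1 : γ < 1)
    (κ : Kernel X X) [IsMarkovKernel κ] (ν : Measure X) [IsProbabilityMeasure ν] {f : X → ℝ}
    (hf : IsBddMeas f) (hf0 : ∀ x, 0 ≤ f x) :
    γ * ∫ x, ∫ y, f y ∂(κ x) ∂(occupancy γ κ ν) ≤ ∫ x, f x ∂(occupancy γ κ ν) := by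
  rw [integral_occupancy_eq h0 h1 κ ν hf]
  have : 0 ≤ ∫ x, f x ∂ν := integral_nonneg hf0
  have := mul_nonneg (by linarith : 0 ≤ 1 - γ) this
  linarith

/-- The term `n = 0` has positive weight. With a Dirac initial law, this turns almost-everywhere
statements into statements at a given state. -/
theorem absolutelyContinuous_occupancy {γ : ℝ} (h0 : 0 < γ) (h1 : γ < 1) (κ : Kernel X X)
    (ν : Measure X) : ν ≪ occupancy γ κ ν := by
  intro s hs
  rw [occupancy_eq h0] at hs
  simp only [Measure.coe_add, Pi.add_apply, Measure.smul_apply, smul_eq_mul, add_eq_zero,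
    mul_eq_zero] at hs
  have : ¬ ENNReal.ofReal (1 - γ) = 0 := by simp [h1]
  tauto

end Occupancy

/-! ### Relative entropy and exponential tilting. -/

section KL

open InformationTheory

/-- The jointly measurable kernel Radon–Nikodym derivative expresses the divergence as a
parametrised integral; absolute continuity fails on a measurable set of states, where the value is
`∞`. -/
theorem measurable_klDiv_kernel {S A : Type*} [MeasurableSpace S] [MeasurableSpace A]
    [MeasurableSpace.CountableOrCountablyGenerated S A] (π η : Kernel S A) [IsFiniteKernel π]
    [IsFiniteKernel η] : Measurable fun s => klDiv (π s) (η s) := by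
  classical
  have h : (fun s => klDiv (π s) (η s)) = fun s => if s ∈ {s | π s ≪ η s} then
      ∫⁻ a, ENNReal.ofReal (klFun (Kernel.rnDeriv π η s a).toReal) ∂(η s) else ∞ := by
    funext s
    rw [klDiv_eq_lintegral_klFun]
    refine if_congr Iff.rfl (lintegral_congr_ae ?_) rfl
    filter_upwards [Kernel.rnDeriv_eq_rnDeriv_measure (κ := π) (η := η) (a := s)] with a ha
    rw [ha]
  rw [h]
  refine Measurable.ite (Kernel.measurableSet_absolutelyContinuous π η) ?_ measurable_const
  refine Measurable.lintegral_kernel_prod_right (κ := η)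
    (f := fun s a => ENNReal.ofReal (klFun (Kernel.rnDeriv π η s a).toReal)) ?_
  have := Kernel.measurable_rnDeriv π η
  exact (measurable_klFun.comp this.ennreal_toReal).ennreal_ofReal

variable {A : Type*} [MeasurableSpace A] {μ : Measure A} [IsProbabilityMeasure μ] {l : A → ℝ}

theorem isProbabilityMeasure_tilted_of_bdd (hl : IsBddMeas l) :
    IsProbabilityMeasure (μ.tilted l) :=
  isProbabilityMeasure_tilted (hl.exp.integrable μ)

theorem tilted_sub_const (μ : Measure A) (l : A → ℝ) (c : ℝ) :
    μ.tilted (fun a => l a - c) = μ.tilted l := by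
  simp only [Measure.tilted, Real.exp_sub, integral_div]
  congr 1
  funext a
  rw [div_div_div_cancel_right₀ (Real.exp_pos c).ne']

theorem integral_exp_sub_log (hl : IsBddMeas l) :
    ∫ a, Real.exp (l a - Real.log (∫ a, Real.exp (l a) ∂μ)) ∂μ = 1 := by
  have h := integral_exp_pos (hl.exp.integrable μ)
  simp only [Real.exp_sub, integral_div, Real.exp_log h]
  exact div_self h.ne'

theorem llr_tilted_self (hl : IsBddMeas l) (h1 : ∫ a, Real.exp (l a) ∂μ = 1) :
    llr (μ.tilted l) μ =ᵐ[μ] l := by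
  have := log_rnDeriv_tilted_left_self (hl.exp.integrable μ)
  simpa [h1, llr_def] using this

theorem klDiv_tilted_self_ne_top (hl : IsBddMeas l) (h1 : ∫ a, Real.exp (l a) ∂μ = 1) :
    klDiv (μ.tilted l) μ ≠ ∞ := by
  have := isProbabilityMeasure_tilted_of_bdd (μ := μ) hl
  have hac := tilted_absolutelyContinuous μ l
  exact klDiv_ne_top hac
    ((integrable_congr (hac.ae_le (llr_tilted_self hl h1))).2 (hl.integrable _))

theorem toReal_klDiv_tilted_self (hl : IsBddMeas l) (h1 : ∫ a, Real.exp (l a) ∂μ = 1) :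
    (klDiv (μ.tilted l) μ).toReal = ∫ a, l a ∂(μ.tilted l) := by
  have := isProbabilityMeasure_tilted_of_bdd (μ := μ) hl
  have hac := tilted_absolutelyContinuous μ l
  rw [toReal_klDiv_of_measure_eq hac (by simp),
    integral_congr_ae (hac.ae_le (llr_tilted_self hl h1))]

theorem klDiv_tilted_ne_top (hl : IsBddMeas l) {ν : Measure A}
    [IsProbabilityMeasure ν] (hν : klDiv ν μ ≠ ∞) : klDiv ν (μ.tilted l) ≠ ∞ := by
  obtain ⟨hac, hint⟩ := klDiv_ne_top_iff.1 hν
  have he := hl.exp.integrable μ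
  exact klDiv_ne_top (hac.trans (absolutelyContinuous_tilted he))
    (integrable_llr_tilted_right hac (hl.integrable ν) hint he)

theorem toReal_klDiv_tilted (hl : IsBddMeas l) (h1 : ∫ a, Real.exp (l a) ∂μ = 1) {ν : Measure A}
    [IsProbabilityMeasure ν] (hν : klDiv ν μ ≠ ∞) :
    (klDiv ν (μ.tilted l)).toReal = (klDiv ν μ).toReal - ∫ a, l a ∂ν := by
  have := isProbabilityMeasure_tilted_of_bdd (μ := μ) hl
  obtain ⟨hac, hint⟩ := klDiv_ne_top_iff.1 hν
  have he := hl.exp.integrable μ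
  rw [toReal_klDiv_of_measure_eq (hac.trans (absolutelyContinuous_tilted he)) (by simp),
    integral_llr_tilted_right hac (hl.integrable ν) he hint, h1,
    toReal_klDiv_of_measure_eq hac (by simp), Real.log_one, add_zero]

/-- The Gibbs variational inequality: the difference of the two sides is the divergence of `ν` from
the tilted measure. -/
theorem integral_le_toReal_klDiv (hl : IsBddMeas l) (h1 : ∫ a, Real.exp (l a) ∂μ = 1)
    {ν : Measure A} [IsProbabilityMeasure ν] (hν : klDiv ν μ ≠ ∞) :
    ∫ a, l a ∂ν ≤ (klDiv ν μ).toReal := by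
  have := toReal_klDiv_tilted hl h1 hν
  have := ENNReal.toReal_nonneg (a := klDiv ν (μ.tilted l))
  linarith

end KL

/-! ### Policies with bounded log-densities. -/

namespace EntropyMDP

open InformationTheory

variable {S A : Type*} [MeasurableSpace S] [MeasurableSpace A] (M : EntropyMDP S A)

/-- `l` is a bounded log-density of the policy `π` with respect to the reference measure. -/
structure IsLogDensity (l : S × A → ℝ) (π : Kernel S A) : Prop where
  bdd : IsBddMeas l
  integral_exp : ∀ s, ∫ a, Real.exp (l (s, a)) ∂M.μ = 1
  eq_tilted : ∀ s, π s = M.μ.tilted fun a => l (s, a)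

/-- Normalisation of a log-density. -/
noncomputable def normalise (f : S × A → ℝ) (p : S × A) : ℝ :=
  f p - Real.log (∫ a, Real.exp (f (p.1, a)) ∂M.μ)

variable {M}

theorem section_bdd {l : S × A → ℝ} (hl : IsBddMeas l) (s : S) : IsBddMeas fun a => l (s, a) :=
  hl.comp measurable_prodMk_left

theorem isBddMeas_log_integral_exp {f : S × A → ℝ} (hf : IsBddMeas f) :
    IsBddMeas fun s => Real.log (∫ a, Real.exp (f (s, a)) ∂M.μ) := by
  refine ⟨(hf.exp.integral_prod M.μ).1.log, ?_⟩
  obtain ⟨B, hB⟩ := hf.2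
  refine ⟨B, fun s => ?_⟩
  have hi := (section_bdd hf.exp s).integrable M.μ
  have hpos := integral_exp_pos (μ := M.μ) (f := fun a => f (s, a)) hi
  rw [abs_le]
  constructor
  · rw [Real.le_log_iff_exp_le hpos]
    simpa using integral_mono (μ := M.μ) (integrable_const (Real.exp (-B))) hi fun a =>
      Real.exp_le_exp.2 (abs_le.1 (hB (s, a))).1
  · rw [Real.log_le_iff_le_exp hpos]
    simpa using integral_mono (μ := M.μ) hi (integrable_const (Real.exp B)) fun a =>
      Real.exp_le_exp.2 (abs_le.1 (hB (s, a))).2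

theorem isBddMeas_normalise {f : S × A → ℝ} (hf : IsBddMeas f) : IsBddMeas (M.normalise f) :=
  hf.sub ((isBddMeas_log_integral_exp (M := M) hf).comp measurable_fst)

theorem integral_exp_normalise {f : S × A → ℝ} (hf : IsBddMeas f) (s : S) :
    ∫ a, Real.exp (M.normalise f (s, a)) ∂M.μ = 1 :=
  integral_exp_sub_log (section_bdd hf s)

theorem tilted_normalise (f : S × A → ℝ) (s : S) :
    M.μ.tilted (fun a => M.normalise f (s, a)) = M.μ.tilted fun a => f (s, a) :=
  tilted_sub_const M.μ (fun a => f (s, a)) (Real.log (∫ a, Real.exp (f (s, a)) ∂M.μ))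

theorem IsAdmissible.exists_isLogDensity {π : Kernel S A} (h : M.IsAdmissible π) :
    ∃ l, M.IsLogDensity l π := by
  obtain ⟨-, f, hf, hB, hπ⟩ := h
  exact ⟨M.normalise f, isBddMeas_normalise ⟨hf, hB⟩, integral_exp_normalise ⟨hf, hB⟩,
    fun s => by rw [tilted_normalise, hπ]⟩

theorem IsLogDensity.isMarkovKernel {l : S × A → ℝ} {π : Kernel S A} (h : M.IsLogDensity l π) :
    IsMarkovKernel π :=
  ⟨fun s => by
    rw [h.eq_tilted]
    exact isProbabilityMeasure_tilted_of_bdd (section_bdd h.bdd s)⟩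

theorem IsLogDensity.isAdmissible {l : S × A → ℝ} {π : Kernel S A} (h : M.IsLogDensity l π) :
    M.IsAdmissible π :=
  ⟨h.isMarkovKernel, l, h.bdd.1, h.bdd.2, h.eq_tilted⟩

variable (M) in
theorem exists_kernel_isLogDensity {l : S × A → ℝ} (hl : IsBddMeas l)
    (h1 : ∀ s, ∫ a, Real.exp (l (s, a)) ∂M.μ = 1) : ∃ π : Kernel S A, M.IsLogDensity l π := by
  refine ⟨Kernel.withDensity (Kernel.const S M.μ)
    fun s a => ENNReal.ofReal (Real.exp (l (s, a))), hl, h1, fun s => ?_⟩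
  have hm : Measurable (Function.uncurry fun s a => ENNReal.ofReal (Real.exp (l (s, a)))) :=
    hl.exp.1.ennreal_ofReal
  rw [Kernel.withDensity_apply _ hm, Kernel.const_apply, Measure.tilted, h1]
  simp

theorem IsLogDensity.klDiv_ne_top {l : S × A → ℝ} {π : Kernel S A} (h : M.IsLogDensity l π)
    (s : S) : klDiv (π s) M.μ ≠ ∞ := by
  rw [h.eq_tilted]
  exact klDiv_tilted_self_ne_top (section_bdd h.bdd s) (h.integral_exp s)

theorem IsLogDensity.toReal_klDiv {l : S × A → ℝ} {π : Kernel S A} (h : M.IsLogDensity l π)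
    (s : S) : (klDiv (π s) M.μ).toReal = ∫ a, l (s, a) ∂(π s) := by
  rw [h.eq_tilted]
  exact toReal_klDiv_tilted_self (section_bdd h.bdd s) (h.integral_exp s)

theorem IsLogDensity.integral_le {l : S × A → ℝ} {π : Kernel S A} (h : M.IsLogDensity l π)
    (s : S) {ν : Measure A} [IsProbabilityMeasure ν] (hν : klDiv ν M.μ ≠ ∞) :
    ∫ a, l (s, a) ∂ν ≤ (klDiv ν M.μ).toReal :=
  integral_le_toReal_klDiv (section_bdd h.bdd s) (h.integral_exp s) hν

theorem IsLogDensity.isBddMeas_toReal_klDiv {l : S × A → ℝ} {π : Kernel S A}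
    (h : M.IsLogDensity l π) : IsBddMeas fun s => (klDiv (π s) M.μ).toReal := by
  have := h.isMarkovKernel
  simpa only [h.toReal_klDiv] using h.bdd.integral_kernel_prod π

theorem isBddMeas_cost : IsBddMeas M.cost := ⟨M.measurable_cost, M.bounded_cost⟩

end EntropyMDP

/-! ### Value functions and the performance difference identity. -/

namespace EntropyMDP

open InformationTheory

variable {S A : Type*} [MeasurableSpace S] [MeasurableSpace A] {M : EntropyMDP S A}

instance isMarkovKernel_stateKernel (π : Kernel S A) [IsMarkovKernel π] :
    IsMarkovKernel (M.stateKernel π) := by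
  unfold stateKernel; infer_instance

instance isMarkovKernel_stateActionKernel (π : Kernel S A) [IsMarkovKernel π] :
    IsMarkovKernel (M.stateActionKernel π) := by
  unfold stateActionKernel; infer_instance

theorem stateOccupancy_eq (π : Kernel S A) (ρ : Measure S) :
    M.stateOccupancy π ρ = occupancy M.γ (M.stateKernel π) ρ := rfl

instance isProbabilityMeasure_stateOccupancy (π : Kernel S A) [IsMarkovKernel π] (ρ : Measure S)
    [IsProbabilityMeasure ρ] : IsProbabilityMeasure (M.stateOccupancy π ρ) :=
  isProbabilityMeasure_occupancy M.γ_pos M.γ_lt_one _ _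

instance isProbabilityMeasure_stateActionOccupancy (π : Kernel S A) [IsMarkovKernel π]
    (β : Measure (S × A)) [IsProbabilityMeasure β] :
    IsProbabilityMeasure (M.stateActionOccupancy π β) :=
  isProbabilityMeasure_occupancy M.γ_pos M.γ_lt_one _ _

variable (M) in
/-- The action-value function `c + γ P V` of a function on states. -/
noncomputable def actionValue (V : S → ℝ) (p : S × A) : ℝ :=
  M.cost p + M.γ * ∫ s', V s' ∂(M.P p)

theorem isBddMeas_actionValue {V : S → ℝ} (hV : IsBddMeas V) : IsBddMeas (M.actionValue V) :=
  isBddMeas_cost.add ((hV.integral_kernel M.P).const_mul M.γ)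

theorem abs_actionValue_sub_le {V W : S → ℝ} (hV : IsBddMeas V) (hW : IsBddMeas W) {C : ℝ}
    (hC : ∀ s, |V s - W s| ≤ C) (p : S × A) :
    |M.actionValue V p - M.actionValue W p| ≤ M.γ * C := by
  have h : M.actionValue V p - M.actionValue W p = M.γ * ∫ s', (V s' - W s') ∂(M.P p) := by
    rw [integral_sub (hV.integrable _) (hW.integrable _)]
    unfold actionValue
    ring
  rw [h, abs_mul, abs_of_pos M.γ_pos]
  exact mul_le_mul_of_nonneg_left (IsBddMeas.abs_integral_le hC _) M.γ_pos.le

theorem integral_stateKernel (π : Kernel S A) [IsMarkovKernel π] {W : S → ℝ} (hW : IsBddMeas W)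
    (s : S) :
    ∫ s', W s' ∂(M.stateKernel π s) = ∫ a, ∫ s', W s' ∂(M.P (s, a)) ∂(π s) := by
  rw [stateKernel, Kernel.integral_comp (hW.integrable _), Kernel.prod_apply, Kernel.id_apply,
    Measure.dirac_prod, integral_map measurable_prodMk_left.aemeasurable
      (hW.integral_kernel M.P).1.aestronglyMeasurable]

theorem integral_actionValue (π : Kernel S A) [IsMarkovKernel π] {W : S → ℝ} (hW : IsBddMeas W)
    (s : S) :
    ∫ a, M.actionValue W (s, a) ∂(π s) =
      ∫ a, M.cost (s, a) ∂(π s) + M.γ * ∫ s', W s' ∂(M.stateKernel π s) := by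
  rw [integral_stateKernel π hW, ← integral_const_mul]
  exact integral_add ((section_bdd isBddMeas_cost s).integrable _)
    ((section_bdd ((hW.integral_kernel M.P).const_mul M.γ) s).integrable _)

/-- Sum and integral are exchanged by geometric domination; the KL counterpart is Tonelli in `ℝ≥0∞`
and allows infinite values. -/
theorem integral_costPart (π : Kernel S A) [IsMarkovKernel π] (ρ : Measure S)
    [IsProbabilityMeasure ρ] :
    (1 - M.γ) * ∫ s, M.costPart π s ∂ρ =
      ∫ s, ∫ a, M.cost (s, a) ∂(π s) ∂(M.stateOccupancy π ρ) := by
  have hc : IsBddMeas fun s => ∫ a, M.cost (s, a) ∂(π s) :=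
    isBddMeas_cost.integral_kernel_prod π
  rw [stateOccupancy_eq, integral_occupancy M.γ_pos M.γ_lt_one _ _ hc]
  obtain ⟨B, hB⟩ := hc.2
  have hF : ∀ n : ℕ, IsBddMeas fun s =>
      M.γ ^ n * ∫ s', (∫ a, M.cost (s', a) ∂(π s')) ∂((M.stateKernel π ^ n) s) := fun n =>
    (hc.integral_kernel (M.stateKernel π ^ n)).const_mul _
  have hs := hasSum_integral_of_summable_integral_norm (μ := ρ)
    (fun n => (hF n).integrable ρ) (by
      refine Summable.of_nonneg_of_le (fun n => integral_nonneg fun _ => norm_nonneg _) (fun n => ?_)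
        ((summable_geometric_of_lt_one M.γ_pos.le M.γ_lt_one).mul_right B)
      have h : ∀ s, ‖M.γ ^ n * ∫ s', (∫ a, M.cost (s', a) ∂(π s')) ∂((M.stateKernel π ^ n) s)‖
          ≤ M.γ ^ n * B := by
        intro s
        rw [norm_mul, norm_pow, Real.norm_of_nonneg M.γ_pos.le]
        exact mul_le_mul_of_nonneg_left (IsBddMeas.abs_integral_le hB _) (pow_nonneg M.γ_pos.le n)
      simpa using integral_mono (μ := ρ) ((hF n).integrable ρ).norm (integrable_const _) h)
  have h2 : ∫ s, M.costPart π s ∂ρ = _ := hs.tsum_eq.symm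
  rw [h2, ← tsum_mul_left]
  refine tsum_congr fun n => ?_
  rw [integral_const_mul]
  ring

theorem value_eq_valueAt_dirac [MeasurableSingletonClass S] (π : Kernel S A) (s : S) :
    M.value π s = M.valueAt π (Measure.dirac s) := by
  simp [value, valueAt]

variable (M) in
/-- The value function of a policy of finite value, as a real function. -/
noncomputable def realValue (π : Kernel S A) (s : S) : ℝ := (M.value π s).toReal

theorem qValue_eq (π : Kernel S A) : M.qValue π = M.actionValue (M.realValue π) := rfl

variable [MeasurableSpace.CountableOrCountablyGenerated S A]

theorem measurable_klDiv (π : Kernel S A) [IsMarkovKernel π] :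
    Measurable fun s => klDiv (π s) M.μ :=
  measurable_klDiv_kernel π (Kernel.const S M.μ)

theorem lintegral_klPart (π : Kernel S A) [IsMarkovKernel π] (ρ : Measure S) :
    ENNReal.ofReal (1 - M.γ) * ∫⁻ s, M.klPart π s ∂ρ =
      ENNReal.ofReal M.τ * ∫⁻ s, klDiv (π s) M.μ ∂(M.stateOccupancy π ρ) := by
  have hk := measurable_klDiv (M := M) π
  have hγ : 0 ≤ 1 - M.γ := by linarith [M.γ_lt_one]
  rw [stateOccupancy_eq, lintegral_occupancy _ _ _ hk]
  unfold klPart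
  rw [lintegral_tsum fun n => (hk.lintegral_kernel.const_mul _).aemeasurable,
    ← ENNReal.tsum_mul_left, ← ENNReal.tsum_mul_left]
  refine tsum_congr fun n => ?_
  rw [lintegral_const_mul _ hk.lintegral_kernel, ← mul_assoc, ← mul_assoc, ← ENNReal.ofReal_mul hγ,
    ← ENNReal.ofReal_mul M.τ_pos.le]
  congr 2
  ring

/-- The performance difference identity against a bounded function `W` in place of a value
function. -/
theorem exists_valueAt_eq (π : Kernel S A) [IsMarkovKernel π] (ρ : Measure S)
    [IsProbabilityMeasure ρ] (htop : M.valueAt π ρ ≠ ⊤) :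
    ∃ v : ℝ, M.valueAt π ρ = v ∧
      Integrable (fun s => (klDiv (π s) M.μ).toReal) (M.stateOccupancy π ρ) ∧
      (∀ᵐ s ∂(M.stateOccupancy π ρ), klDiv (π s) M.μ ≠ ∞) ∧
      ∀ W : S → ℝ, IsBddMeas W → (1 - M.γ) * (v - ∫ s, W s ∂ρ) =
        ∫ s, (∫ a, M.actionValue W (s, a) ∂(π s) + M.τ * (klDiv (π s) M.μ).toReal - W s)
          ∂(M.stateOccupancy π ρ) := by
  have hγ : 0 < 1 - M.γ := by linarith [M.γ_lt_one]
  have hk := measurable_klDiv (M := M) π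
  have hkl := lintegral_klPart (M := M) π ρ
  have hfin : ∫⁻ s, M.klPart π s ∂ρ ≠ ∞ := by
    intro h
    apply htop
    unfold valueAt
    rw [h]
    simp
  have hfin' : ∫⁻ s, klDiv (π s) M.μ ∂(M.stateOccupancy π ρ) ≠ ∞ := by
    intro h
    rw [h, ENNReal.mul_top (by simpa using M.τ_pos)] at hkl
    exact ENNReal.mul_ne_top ENNReal.ofReal_ne_top hfin hkl
  have hint := integrable_toReal_of_lintegral_ne_top hk.aemeasurable hfin'
  have hae := ae_lt_top hk hfin'
  refine ⟨∫ s, M.costPart π s ∂ρ + (∫⁻ s, M.klPart π s ∂ρ).toReal, ?_, hint,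
    hae.mono fun s hs => hs.ne, fun W hW => ?_⟩
  · unfold valueAt
    conv_lhs => rw [← ENNReal.ofReal_toReal hfin]
    rw [EReal.coe_ennreal_ofReal, max_eq_left ENNReal.toReal_nonneg, EReal.coe_add]
  · have h1 := integral_costPart (M := M) π ρ
    have h2 : (1 - M.γ) * (∫⁻ s, M.klPart π s ∂ρ).toReal =
        M.τ * ∫ s, (klDiv (π s) M.μ).toReal ∂(M.stateOccupancy π ρ) := by
      have := congrArg ENNReal.toReal hkl
      rw [ENNReal.toReal_mul, ENNReal.toReal_mul, ENNReal.toReal_ofReal hγ.le,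
        ENNReal.toReal_ofReal M.τ_pos.le] at this
      rw [this, integral_toReal hk.aemeasurable hae]
    -- The flow equation rewrites `(1 - γ) ∫ W dρ` as the occupancy integral of `W - γ P_π W`.
    have h3 := integral_occupancy_eq M.γ_pos M.γ_lt_one (M.stateKernel π) ρ hW
    rw [← stateOccupancy_eq] at h3
    simp only [integral_actionValue π hW]
    have i1 := (isBddMeas_cost (M := M).integral_kernel_prod π).integrable (M.stateOccupancy π ρ)
    have i2 := ((hW.integral_kernel (M.stateKernel π)).const_mul M.γ).integrable
      (M.stateOccupancy π ρ)
    refine Eq.trans ?_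
      (integral_sub ((i1.add i2).add (hint.const_mul M.τ)) (hW.integrable _)).symm
    rw [integral_add' (i1.add i2) (hint.const_mul _), integral_add' i1 i2, integral_const_mul,
      integral_const_mul, h3]
    linarith

theorem IsLogDensity.valueAt_ne_top {l : S × A → ℝ} {π : Kernel S A} (h : M.IsLogDensity l π)
    (ρ : Measure S) [IsProbabilityMeasure ρ] : M.valueAt π ρ ≠ ⊤ := by
  have := h.isMarkovKernel
  obtain ⟨B, hB⟩ := h.isBddMeas_toReal_klDiv.2
  have hkl := lintegral_klPart (M := M) π ρ
  have h1 : ∫⁻ s, klDiv (π s) M.μ ∂(M.stateOccupancy π ρ) ≠ ∞ := by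
    refine ne_top_of_le_ne_top (ENNReal.ofReal_ne_top (r := B)) ?_
    have : ∫⁻ s, klDiv (π s) M.μ ∂(M.stateOccupancy π ρ) ≤
        ∫⁻ _, ENNReal.ofReal B ∂(M.stateOccupancy π ρ) := lintegral_mono fun s => by
      rw [← ENNReal.ofReal_toReal (h.klDiv_ne_top s)]
      exact ENNReal.ofReal_le_ofReal ((le_abs_self _).trans (hB s))
    simpa using this
  have h2 : ∫⁻ s, M.klPart π s ∂ρ ≠ ∞ := by
    intro h2
    rw [h2, ENNReal.mul_top (by simpa using M.γ_lt_one)] at hkl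
    exact ENNReal.mul_ne_top ENNReal.ofReal_ne_top h1 hkl.symm
  unfold valueAt
  rw [← ENNReal.ofReal_toReal h2, EReal.coe_ennreal_ofReal, ← EReal.coe_add]
  exact EReal.coe_ne_top _

/-- A bounded solution of the Bellman equation of a policy is its value function. -/
theorem IsLogDensity.valueAt_eq_of_bellman {l : S × A → ℝ} {π : Kernel S A}
    (h : M.IsLogDensity l π) {W : S → ℝ} (hW : IsBddMeas W)
    (hWeq : ∀ s, W s = ∫ a, M.actionValue W (s, a) ∂(π s) + M.τ * (klDiv (π s) M.μ).toReal)
    (ρ : Measure S) [IsProbabilityMeasure ρ] : M.valueAt π ρ = ((∫ s, W s ∂ρ : ℝ) : EReal) := by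
  have := h.isMarkovKernel
  obtain ⟨v, hv, -, -, hd⟩ := exists_valueAt_eq π ρ (h.valueAt_ne_top ρ)
  have h1 := hd W hW
  simp only [← hWeq, sub_self, integral_zero] at h1
  rcases mul_eq_zero.1 h1 with h2 | h2
  · linarith [M.γ_lt_one]
  · rw [hv, sub_eq_zero.1 h2]

variable [MeasurableSingletonClass S]

/-- The evaluation equation is solved by a fixed point, and the performance difference identity at
Dirac initial laws identifies that solution with the value. -/
theorem IsLogDensity.isBddMeas_realValue_and_bellman {l : S × A → ℝ} {π : Kernel S A}
    (h : M.IsLogDensity l π) : IsBddMeas (M.realValue π) ∧ ∀ s, M.realValue π s =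
      ∫ a, M.actionValue (M.realValue π) (s, a) ∂(π s) + M.τ * (klDiv (π s) M.μ).toReal := by
  have := h.isMarkovKernel
  obtain ⟨W, hW, hWeq⟩ := IsBddMeas.exists_eq_add_mul_integral (κ := M.stateKernel π)
    ((isBddMeas_cost (M := M).integral_kernel_prod π).add
      (h.isBddMeas_toReal_klDiv.const_mul M.τ)) M.γ_pos M.γ_lt_one
  have hWeq' : ∀ s, W s =
      ∫ a, M.actionValue W (s, a) ∂(π s) + M.τ * (klDiv (π s) M.μ).toReal := fun s => by
    rw [integral_actionValue π hW, hWeq]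
    ring
  have hR : M.realValue π = W := by
    funext s
    rw [realValue, value_eq_valueAt_dirac, h.valueAt_eq_of_bellman hW hWeq' (Measure.dirac s)]
    simp
  rw [hR]
  exact ⟨hW, hWeq'⟩

theorem IsLogDensity.isBddMeas_realValue {l : S × A → ℝ} {π : Kernel S A}
    (h : M.IsLogDensity l π) : IsBddMeas (M.realValue π) := h.isBddMeas_realValue_and_bellman.1

theorem IsLogDensity.realValue_eq {l : S × A → ℝ} {π : Kernel S A} (h : M.IsLogDensity l π)
    (s : S) : M.realValue π s =
      ∫ a, M.actionValue (M.realValue π) (s, a) ∂(π s) + M.τ * ∫ a, l (s, a) ∂(π s) := by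
  rw [← h.toReal_klDiv]
  exact h.isBddMeas_realValue_and_bellman.2 s

theorem IsLogDensity.valueAt_eq {l : S × A → ℝ} {π : Kernel S A} (h : M.IsLogDensity l π)
    (ρ : Measure S) [IsProbabilityMeasure ρ] :
    M.valueAt π ρ = ((∫ s, M.realValue π s ∂ρ : ℝ) : EReal) :=
  h.valueAt_eq_of_bellman h.isBddMeas_realValue h.isBddMeas_realValue_and_bellman.2 ρ

/-- The state-action value function is a fixed point of the Bellman operator. -/
theorem IsLogDensity.bellman_qValue {l : S × A → ℝ} {π : Kernel S A} (h : M.IsLogDensity l π)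
    (p : S × A) : M.bellman π (M.qValue π) p = M.qValue π p := by
  have := h.isMarkovKernel
  have hV := h.isBddMeas_realValue
  have hQ := isBddMeas_actionValue (M := M) hV
  have hkl := h.isBddMeas_toReal_klDiv
  have h1 : ∫ q, M.qValue π q ∂(M.stateActionKernel π p) =
      ∫ s', ∫ a, M.actionValue (M.realValue π) (s', a) ∂(π s') ∂(M.P p) := by
    rw [qValue_eq, stateActionKernel, integral_compProd (hQ.integrable _)]
    simp
  have h2 : ∫ s', M.realValue π s' ∂(M.P p) =
      ∫ s', ∫ a, M.actionValue (M.realValue π) (s', a) ∂(π s') ∂(M.P p) +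
        M.τ * ∫ s', (klDiv (π s') M.μ).toReal ∂(M.P p) := by
    rw [← integral_const_mul, ← integral_add ((hQ.integral_kernel_prod π).integrable _)
      ((hkl.const_mul _).integrable _)]
    exact integral_congr_ae (ae_of_all _ fun s => h.isBddMeas_realValue_and_bellman.2 s)
  rw [bellman, h1, qValue_eq]
  conv_rhs => rw [actionValue, h2]
  ring

end EntropyMDP

/-! ### The soft Bellman equation and an optimal policy. -/

/-- From `f ≤ g + D` follows `exp f ≤ exp D * exp g`. This nonexpansiveness makes the soft Bellman
operator a `γ`-contraction. -/
theorem abs_log_integral_exp_sub_le {A : Type*} [MeasurableSpace A] {μ : Measure A}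
    [IsProbabilityMeasure μ] {f g : A → ℝ} (hf : IsBddMeas f) (hg : IsBddMeas g) {D : ℝ}
    (h : ∀ a, |f a - g a| ≤ D) :
    |Real.log (∫ a, Real.exp (f a) ∂μ) - Real.log (∫ a, Real.exp (g a) ∂μ)| ≤ D := by
  have key : ∀ {f g : A → ℝ}, IsBddMeas f → IsBddMeas g → (∀ a, |f a - g a| ≤ D) →
      Real.log (∫ a, Real.exp (f a) ∂μ) ≤ Real.log (∫ a, Real.exp (g a) ∂μ) + D := by
    intro f g hf hg h
    have hfi := hf.exp.integrable μ
    have hgi := hg.exp.integrable μ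
    rw [Real.log_le_iff_le_exp (integral_exp_pos hfi), Real.exp_add,
      Real.exp_log (integral_exp_pos hgi), ← integral_mul_const]
    refine integral_mono hfi (hgi.mul_const _) fun a => ?_
    simp only [← Real.exp_add]
    exact Real.exp_le_exp.2 (by linarith [(abs_le.1 (h a)).2])
  rw [abs_sub_le_iff]
  have h1 := key hf hg h
  have h2 := key hg hf fun a => by rw [abs_sub_comm]; exact h a
  constructor <;> linarith

namespace EntropyMDP

open InformationTheory

variable {S A : Type*} [MeasurableSpace S] [MeasurableSpace A] (M : EntropyMDP S A)

/-- The soft Bellman optimality equation has a bounded measurable solution. -/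
theorem exists_softBellman : ∃ V : S → ℝ, IsBddMeas V ∧ ∀ s,
    V s = -M.τ * Real.log (∫ a, Real.exp (-M.τ⁻¹ * M.actionValue V (s, a)) ∂M.μ) := by
  have hb : ∀ V, IsBddMeas V → IsBddMeas fun p : S × A => -M.τ⁻¹ * M.actionValue V p :=
    fun V hV => (isBddMeas_actionValue hV).const_mul _
  obtain ⟨V, hV, hT⟩ := IsBddMeas.exists_fixedPoint M.γ_pos M.γ_lt_one
    (fun (V : S → ℝ) s =>
      -M.τ * Real.log (∫ a, Real.exp (-M.τ⁻¹ * M.actionValue V (s, a)) ∂M.μ))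
    (fun V hV => (isBddMeas_log_integral_exp (hb V hV)).const_mul _) (by
      intro V W C hV hW hC s
      have h := abs_log_integral_exp_sub_le (μ := M.μ) (D := M.τ⁻¹ * (M.γ * C))
        (section_bdd (hb V hV) s) (section_bdd (hb W hW) s) (fun a => by
          rw [← mul_sub, abs_mul, abs_neg, abs_of_pos (inv_pos.2 M.τ_pos)]
          exact mul_le_mul_of_nonneg_left (abs_actionValue_sub_le hV hW hC _)
            (inv_pos.2 M.τ_pos).le)
      rw [← mul_sub, abs_mul, abs_neg, abs_of_pos M.τ_pos]
      calc _ ≤ M.τ * (M.τ⁻¹ * (M.γ * C)) := mul_le_mul_of_nonneg_left h M.τ_pos.le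
        _ = M.γ * C := by rw [mul_inv_cancel_left₀ M.τ_pos.ne'])
  exact ⟨V, hV, fun s => (congrFun hT s).symm⟩

variable [MeasurableSpace.CountableOrCountablyGenerated S A]

/-- There is a policy with a bounded log-density that is optimal for all initial distributions. -/
theorem exists_isOptimalPolicy : ∃ (l : S × A → ℝ) (π : Kernel S A), M.IsLogDensity l π ∧
    ∀ ρ : Measure S, IsProbabilityMeasure ρ → M.IsOptimalPolicy ρ π := by
  obtain ⟨V, hV, hVeq⟩ := M.exists_softBellman
  have hf : IsBddMeas fun p : S × A => -M.τ⁻¹ * M.actionValue V p :=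
    (isBddMeas_actionValue hV).const_mul _
  set l := M.normalise fun p => -M.τ⁻¹ * M.actionValue V p with hl
  obtain ⟨π, hπ⟩ := M.exists_kernel_isLogDensity (isBddMeas_normalise (M := M) hf)
    (integral_exp_normalise hf)
  -- By the soft Bellman equation the log partition function is `-V/τ`, so `τ l = V - Q_V`.
  have hlV : ∀ (s : S) (ν : Measure A) [IsProbabilityMeasure ν], M.τ * ∫ a, l (s, a) ∂ν =
      V s - ∫ a, M.actionValue V (s, a) ∂ν := by
    intro s ν _
    have h1 : ∀ a, l (s, a) = M.τ⁻¹ * (V s - M.actionValue V (s, a)) := by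
      intro a
      have := M.τ_pos.ne'
      rw [hl, normalise, hVeq s]
      field_simp
      ring
    simp only [h1]
    rw [integral_const_mul, mul_inv_cancel_left₀ M.τ_pos.ne',
      integral_sub (integrable_const _) ((section_bdd (isBddMeas_actionValue hV) s).integrable ν)]
    simp
  have hπM := hπ.isMarkovKernel
  refine ⟨l, π, hπ, fun ρ hρ => ⟨hπM, le_antisymm ?_ (iInf₂_le π hπM)⟩⟩
  rw [hπ.valueAt_eq_of_bellman hV (fun s => by rw [hπ.toReal_klDiv, hlV s (π s)]; ring) ρ]
  refine le_iInf₂ fun η hη => ?_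
  by_cases htop : M.valueAt η ρ = ⊤
  · rw [htop]; exact le_top
  obtain ⟨v, hv, hint, hae, hd⟩ := exists_valueAt_eq η ρ htop
  rw [hv, EReal.coe_le_coe_iff, ← sub_nonneg]
  refine nonneg_of_mul_nonneg_right (a := 1 - M.γ) ?_ (by linarith [M.γ_lt_one])
  -- With `W = V` the integrand of the performance difference is `τ (KL(η|μ) - ∫ l dη)`, nonnegative
  -- by the Gibbs inequality.
  rw [hd V hV]
  refine integral_nonneg_of_ae ?_
  filter_upwards [hae] with s hs
  have h1 := mul_le_mul_of_nonneg_left (hπ.integral_le s hs) M.τ_pos.le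
  rw [hlV s (η s)] at h1
  simp only [Pi.zero_apply]
  linarith

end EntropyMDP

/-! ### The critic: linear features and temporal difference learning. -/

namespace EntropyMDP

open InformationTheory

open scoped MatrixOrder in
theorem sInf_spectrum_mul_le_dotProduct {N : ℕ} {C : Matrix (Fin N) (Fin N) ℝ}
    (hC : C.IsHermitian) (x : Fin N → ℝ) :
    sInf (spectrum ℝ C) * x ⬝ᵥ x ≤ x ⬝ᵥ C.mulVec x := by
  have hfin : (spectrum ℝ C).Finite := by
    rw [hC.spectrum_real_eq_range_eigenvalues]
    exact Set.finite_range _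
  have h1 : algebraMap ℝ (Matrix (Fin N) (Fin N) ℝ) (sInf (spectrum ℝ C)) ≤ C :=
    (algebraMap_le_iff_le_spectrum (a := C) hC).2 fun y hy => csInf_le hfin.bddBelow hy
  have h2 := (Matrix.le_iff.1 h1).dotProduct_mulVec_nonneg x
  simpa [Matrix.sub_mulVec, Algebra.algebraMap_eq_smul_one, Matrix.smul_mulVec] using h2

variable {S A : Type*} {N : ℕ} {φ : S × A → EuclideanSpace ℝ (Fin N)}

theorem abs_linQ_le (h_bounded : ∀ p, ‖φ p‖ ≤ 1) (θ : EuclideanSpace ℝ (Fin N)) (p : S × A) :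
    |linQ φ θ p| ≤ ‖θ‖ :=
  (abs_real_inner_le_norm _ _).trans (mul_le_of_le_one_right (norm_nonneg _) (h_bounded p))

theorem linQ_sub (θ θ' : EuclideanSpace ℝ (Fin N)) (p : S × A) :
    linQ φ (θ - θ') p = linQ φ θ p - linQ φ θ' p := inner_sub_left _ _ _

variable [MeasurableSpace S] [MeasurableSpace A] {M : EntropyMDP S A}

theorem isBddMeas_linQ (hφ : Measurable φ) (h_bounded : ∀ p, ‖φ p‖ ≤ 1)
    (θ : EuclideanSpace ℝ (Fin N)) : IsBddMeas (linQ φ θ) :=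
  ⟨measurable_const.inner hφ, ‖θ‖, abs_linQ_le h_bounded θ⟩

theorem minEigenvalue_mul_norm_sq_le (hφ : Measurable φ) (h_bounded : ∀ p, ‖φ p‖ ≤ 1)
    (β : Measure (S × A)) [IsProbabilityMeasure β] (x : EuclideanSpace ℝ (Fin N)) :
    minEigenvalue φ β * ‖x‖ ^ 2 ≤ ∫ p, linQ φ x p ^ 2 ∂β := by
  have hC : (featureCov φ β).IsHermitian := by
    ext i j
    simp [featureCov, mul_comm]
  have hcoord : ∀ i, IsBddMeas fun p => φ p i := fun i =>
    ⟨by fun_prop, 1, fun p => (PiLp.norm_apply_le (φ p) i).trans (h_bounded p)⟩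
  have h := sInf_spectrum_mul_le_dotProduct hC x.ofLp
  have h1 : x.ofLp ⬝ᵥ x.ofLp = ‖x‖ ^ 2 := by
    rw [EuclideanSpace.real_norm_sq_eq, dotProduct]
    simp [sq]
  have h2 : x.ofLp ⬝ᵥ (featureCov φ β).mulVec x.ofLp = ∫ p, linQ φ x p ^ 2 ∂β := by
    have h3 : ∀ p, linQ φ x p ^ 2 = ∑ i, ∑ j, x i * x j * (φ p i * φ p j) := by
      intro p
      have : linQ φ x p = ∑ i, x i * φ p i := by
        simp [linQ, PiLp.inner_apply, mul_comm]
      rw [this, sq, Finset.sum_mul_sum]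
      refine Finset.sum_congr rfl fun i _ => Finset.sum_congr rfl fun j _ => by ring
    have hi : ∀ i j, Integrable (fun p => x i * x j * (φ p i * φ p j)) β := fun i j =>
      (((hcoord i).mul (hcoord j)).const_mul _).integrable β
    simp only [h3]
    rw [integral_finsetSum _ fun i _ => integrable_finsetSum _ fun j _ => hi i j]
    simp only [dotProduct, Matrix.mulVec, Finset.mul_sum]
    refine Finset.sum_congr rfl fun i _ => ?_
    rw [integral_finsetSum _ fun j _ => hi i j]
    refine Finset.sum_congr rfl fun j _ => ?_
    rw [integral_const_mul, featureCov, Matrix.of_apply]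
    ring
  rwa [h1, h2] at h

/-- Used to bound the target parameter `θ_π` by the sup norm of `Q^π`. -/
theorem norm_le_of_abs_linQ_le (hφ : Measurable φ) (h_bounded : ∀ p, ‖φ p‖ ≤ 1)
    (β : Measure (S × A)) [IsProbabilityMeasure β] (hmin : 0 < minEigenvalue φ β)
    {x : EuclideanSpace ℝ (Fin N)} {B : ℝ} (hB0 : 0 ≤ B) (hB : ∀ p, |linQ φ x p| ≤ B) :
    ‖x‖ ≤ B / √(minEigenvalue φ β) := by
  have h1 := minEigenvalue_mul_norm_sq_le hφ h_bounded β x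
  have hl := isBddMeas_linQ hφ h_bounded x
  have h2 : ∫ p, linQ φ x p ^ 2 ∂β ≤ B ^ 2 := by
    refine (le_abs_self _).trans (IsBddMeas.abs_integral_le (fun p => ?_) β)
    rw [abs_pow]
    exact pow_le_pow_left₀ (abs_nonneg _) (hB p) 2
  rw [le_div_iff₀ (Real.sqrt_pos.2 hmin)]
  refine abs_le_of_sq_le_sq' ?_ hB0 |>.2
  rw [mul_pow, Real.sq_sqrt hmin.le]
  linarith

/-- Strong monotonicity of the temporal difference operator in the discounted occupancy measure of
a Markov chain. -/
theorem integral_temporalDifference_ge {X : Type*} [MeasurableSpace X] {γ : ℝ} (h0 : 0 < γ)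
    (h1 : γ < 1) (κ : Kernel X X) [IsMarkovKernel κ] (ν : Measure X) [IsProbabilityMeasure ν]
    {f : X → ℝ} (hf : IsBddMeas f) :
    (1 - γ) * (1 - √γ) * ∫ x, f x ^ 2 ∂ν ≤
      ∫ x, (f x - γ * ∫ y, f y ∂(κ x)) * f x ∂(occupancy γ κ ν) := by
  have := isProbabilityMeasure_occupancy h0 h1 κ ν
  have hf2 : IsBddMeas fun x => f x ^ 2 := by simpa only [sq] using hf.mul hf
  have hk := hf.integral_kernel κ
  have hk2 := hf2.integral_kernel κ
  have hs : √γ < 1 := by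
    rw [Real.sqrt_lt' one_pos]
    simpa using h1
  have hsq : √γ ^ 2 = γ := Real.sq_sqrt h0.le
  have h2 := mul_integral_le_integral_occupancy h0 h1 κ ν hf2 fun x => sq_nonneg _
  have h3 := mul_integral_comp_le_integral_occupancy h0 h1 κ ν hf2 fun x => sq_nonneg _
  -- Jensen's inequality for the square, from nonnegativity of the variance.
  have hjensen : ∀ x, (∫ y, f y ∂(κ x)) ^ 2 ≤ ∫ y, f y ^ 2 ∂(κ x) := by
    intro x
    have hn : 0 ≤ ∫ y, (f y - ∫ y, f y ∂(κ x)) ^ 2 ∂(κ x) := integral_nonneg fun _ => sq_nonneg _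
    set m := ∫ y, f y ∂(κ x) with hm
    have e : ∀ y, (f y - m) ^ 2 = f y ^ 2 - 2 * m * f y + m ^ 2 := fun y => by ring
    simp only [e] at hn
    rw [integral_add ((hf2.sub (hf.const_mul _)).integrable _) (integrable_const _),
      integral_sub (hf2.integrable _) ((hf.const_mul _).integrable _), integral_const_mul,
      ← hm] at hn
    simp only [integral_const, probReal_univ, smul_eq_mul, one_mul] at hn
    nlinarith
  -- Young's inequality for `γ m f`, weighted so that after `h3` each half costs `√γ / 2` times the
  -- occupancy integral of `f²`, leaving the factor `1 - √γ`.
  have hpt : ∀ x, f x ^ 2 - √γ / 2 * (f x ^ 2 + γ * ∫ y, f y ^ 2 ∂(κ x)) ≤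
      (f x - γ * ∫ y, f y ∂(κ x)) * f x := by
    intro x
    have hj := hjensen x
    set m := ∫ y, f y ∂(κ x)
    have e : √γ / 2 * (f x ^ 2 + γ * m ^ 2) - γ * m * f x = √γ / 2 * (f x - √γ * m) ^ 2 := by
      rw [sub_sq, mul_pow, hsq]
      linear_combination (m * f x) * hsq
    have h4 : 0 ≤ √γ / 2 * (f x - √γ * m) ^ 2 := by positivity
    have h5 : √γ / 2 * (f x ^ 2 + γ * m ^ 2) ≤
        √γ / 2 * (f x ^ 2 + γ * ∫ y, f y ^ 2 ∂(κ x)) := by gcongr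
    nlinarith
  have hb1 := hf2.add (hk2.const_mul γ)
  have h6 := integral_mono (μ := occupancy γ κ ν) ((hf2.sub (hb1.const_mul (√γ / 2))).integrable _)
    (((hf.sub (hk.const_mul γ)).mul hf).integrable _) hpt
  rw [integral_sub (hf2.integrable _) ((hb1.const_mul _).integrable _), integral_const_mul,
    integral_add (hf2.integrable _) ((hk2.const_mul _).integrable _), integral_const_mul] at h6
  refine le_trans ?_ h6
  have hI : 0 ≤ √γ / 2 := by positivity
  have h7 := mul_le_mul_of_nonneg_left h3 hI
  have h8 := mul_le_mul_of_nonneg_left h2 (by linarith : 0 ≤ 1 - √γ)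
  nlinarith

variable [MeasurableSpace.CountableOrCountablyGenerated S A] [MeasurableSingletonClass S]

/-- `Q^π` is a fixed point of the Bellman operator, so the cost and KL terms cancel and the residual
is linear in `θ - θs`. -/
theorem IsLogDensity.temporalDifference_eq {l : S × A → ℝ} {π : Kernel S A}
    (hπ : M.IsLogDensity l π) (hφ : Measurable φ) (h_bounded : ∀ p, ‖φ p‖ ≤ 1)
    {θs : EuclideanSpace ℝ (Fin N)} (hθs : ∀ p, M.qValue π p = linQ φ θs p)
    (θ : EuclideanSpace ℝ (Fin N)) (p : S × A) :
    linQ φ θ p - M.bellman π (linQ φ θ) p =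
      linQ φ (θ - θs) p - M.γ * ∫ q, linQ φ (θ - θs) q ∂(M.stateActionKernel π p) := by
  have := hπ.isMarkovKernel
  have h := hπ.bellman_qValue p
  rw [funext hθs] at h
  have e : ∫ q, linQ φ (θ - θs) q ∂(M.stateActionKernel π p) =
      ∫ q, linQ φ θ q ∂(M.stateActionKernel π p) -
        ∫ q, linQ φ θs q ∂(M.stateActionKernel π p) := by
    simp only [linQ_sub]
    exact integral_sub ((isBddMeas_linQ hφ h_bounded θ).integrable _)
      ((isBddMeas_linQ hφ h_bounded θs).integrable _)
  rw [e, linQ_sub]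
  unfold bellman at h ⊢
  linarith

/-- Expanding the square, strong monotonicity contributes `-2hΓ‖x‖²` and the step size bound limits
the quadratic term to `hΓ‖x‖²`; finally `1 - hΓ ≤ exp (-hΓ)`. -/
theorem IsLogDensity.norm_td_step_sq_le {l : S × A → ℝ} {π : Kernel S A}
    (hπ : M.IsLogDensity l π) (hφ : Measurable φ) (h_bounded : ∀ p, ‖φ p‖ ≤ 1)
    (β : Measure (S × A)) [IsProbabilityMeasure β] {h : ℝ} (hh : 0 < h)
    (hh' : h < M.Gam φ β / (2 * (1 + M.γ)))
    {θs : EuclideanSpace ℝ (Fin N)} (hθs : ∀ p, M.qValue π p = linQ φ θs p)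
    (θ : EuclideanSpace ℝ (Fin N)) :
    ‖θ - h • M.semiGradient φ β θ π - θs‖ ^ 2 ≤ Real.exp (-(h * M.Gam φ β)) * ‖θ - θs‖ ^ 2 := by
  have := hπ.isMarkovKernel
  have hγ := M.γ_pos
  set x := θ - θs with hx
  set g := M.semiGradient φ β θ π with hg
  have hlin := isBddMeas_linQ hφ h_bounded x
  have hδ := hlin.sub ((hlin.integral_kernel (M.stateActionKernel π)).const_mul M.γ)
  have hgeq : g = ∫ p, (linQ φ x p - M.γ * ∫ q, linQ φ x q ∂(M.stateActionKernel π p)) • φ p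
      ∂(M.stateActionOccupancy π β) := by
    rw [hg, semiGradient]
    simp only [hπ.temporalDifference_eq hφ h_bounded hθs θ, ← hx]
  have hδb : ∀ p, ‖(linQ φ x p - M.γ * ∫ q, linQ φ x q ∂(M.stateActionKernel π p)) • φ p‖ ≤
      (1 + M.γ) * ‖x‖ := by
    intro p
    rw [norm_smul]
    refine (mul_le_of_le_one_right (norm_nonneg _) (h_bounded p)).trans ?_
    refine (norm_sub_le _ _).trans ?_
    rw [norm_mul, Real.norm_of_nonneg hγ.le, add_mul, one_mul]
    exact add_le_add (abs_linQ_le h_bounded x p) (mul_le_mul_of_nonneg_left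
      (IsBddMeas.abs_integral_le (abs_linQ_le h_bounded x) _) hγ.le)
  have hgn : ‖g‖ ≤ (1 + M.γ) * ‖x‖ := by
    rw [hgeq]
    simpa using norm_integral_le_of_norm_le_const (μ := M.stateActionOccupancy π β)
      (ae_of_all _ hδb)
  have hinner : M.Gam φ β * ‖x‖ ^ 2 ≤ inner ℝ x g := by
    have hint : Integrable (fun p =>
        (linQ φ x p - M.γ * ∫ q, linQ φ x q ∂(M.stateActionKernel π p)) • φ p)
        (M.stateActionOccupancy π β) :=
      Integrable.of_bound (hδ.1.smul hφ).aestronglyMeasurable _ (ae_of_all _ hδb)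
    rw [hgeq, ← integral_inner hint x]
    simp only [inner_smul_right]
    refine le_trans ?_ (integral_temporalDifference_ge M.γ_pos M.γ_lt_one
      (M.stateActionKernel π) β hlin)
    rw [Gam, mul_assoc]
    refine mul_le_mul_of_nonneg_left (minEigenvalue_mul_norm_sq_le hφ h_bounded β x) ?_
    have hs : √M.γ < 1 := by
      rw [Real.sqrt_lt' one_pos]
      simpa using M.γ_lt_one
    exact mul_nonneg (by linarith [M.γ_lt_one]) (by linarith)
  have e : θ - h • g - θs = x - h • g := by rw [hx]; abel
  rw [e, norm_sub_sq_real, inner_smul_right, norm_smul, Real.norm_of_nonneg hh.le]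
  have hG : h * (2 * (1 + M.γ)) < M.Gam φ β := (lt_div_iff₀ (by positivity)).1 hh'
  have h1 : (h * ‖g‖) ^ 2 ≤ h * M.Gam φ β * ‖x‖ ^ 2 := by
    have h2 : ‖g‖ ^ 2 ≤ ((1 + M.γ) * ‖x‖) ^ 2 := pow_le_pow_left₀ (norm_nonneg _) hgn 2
    have h3 : h * (1 + M.γ) ^ 2 ≤ M.Gam φ β := by
      nlinarith [M.γ_lt_one, mul_pos hh hγ]
    calc (h * ‖g‖) ^ 2 = h ^ 2 * ‖g‖ ^ 2 := by ring
      _ ≤ h ^ 2 * ((1 + M.γ) * ‖x‖) ^ 2 := by gcongr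
      _ = h * (h * (1 + M.γ) ^ 2) * ‖x‖ ^ 2 := by ring
      _ ≤ h * M.Gam φ β * ‖x‖ ^ 2 := by gcongr
  have h4 := mul_le_mul_of_nonneg_left hinner hh.le
  have h5 := mul_le_mul_of_nonneg_right (Real.add_one_le_exp (-(h * M.Gam φ β)))
    (sq_nonneg ‖x‖)
  nlinarith

/-- The inner loop of the critic contracts the distance to the parameter of `Q^π`. -/
theorem IsLogDensity.norm_td_iterate_le {l : S × A → ℝ} {π : Kernel S A}
    (hπ : M.IsLogDensity l π) (hφ : Measurable φ) (h_bounded : ∀ p, ‖φ p‖ ≤ 1)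
    (β : Measure (S × A)) [IsProbabilityMeasure β] {h : ℝ} (hh : 0 < h)
    (hh' : h < M.Gam φ β / (2 * (1 + M.γ)))
    {θs : EuclideanSpace ℝ (Fin N)} (hθs : ∀ p, M.qValue π p = linQ φ θs p)
    (θ : EuclideanSpace ℝ (Fin N)) {k : ℕ} {y : ℝ} (hy : 0 < y)
    (hk : 4 / (h * M.Gam φ β) * Real.log y ≤ k) :
    ‖(fun ϑ => ϑ - h • M.semiGradient φ β ϑ π)^[k] θ - θs‖ ≤ min 1 (y ^ 2)⁻¹ * ‖θ - θs‖ := by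
  have hγ := M.γ_pos
  have hG : 0 < M.Gam φ β := by
    have : 0 < M.Gam φ β / (2 * (1 + M.γ)) := hh.trans hh'
    exact (div_pos_iff_of_pos_right (by positivity)).1 this
  have hhG := mul_pos hh hG
  have hit : ∀ k : ℕ, ‖(fun ϑ => ϑ - h • M.semiGradient φ β ϑ π)^[k] θ - θs‖ ^ 2 ≤
      Real.exp (-(h * M.Gam φ β) * k) * ‖θ - θs‖ ^ 2 := by
    intro k
    induction k with
    | zero => simp
    | succ k ih =>
      rw [Function.iterate_succ_apply']
      refine (hπ.norm_td_step_sq_le hφ h_bounded β hh hh' hθs _).trans ?_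
      refine (mul_le_mul_of_nonneg_left ih (Real.exp_pos _).le).trans_eq ?_
      rw [← mul_assoc, ← Real.exp_add]
      push_cast
      ring_nf
  have hk' : 4 * Real.log y ≤ h * M.Gam φ β * k := by
    rw [div_mul_eq_mul_div, div_le_iff₀ hhG] at hk
    linarith
  refine abs_le_of_sq_le_sq' ((hit k).trans ?_) (by positivity) |>.2
  rw [mul_pow]
  refine mul_le_mul_of_nonneg_right ?_ (sq_nonneg _)
  -- The squared norm shrinks by `exp (-hΓk) ≤ y⁻⁴`, the norm by `y⁻²`. The bound `1` covers `y <
  -- 1`, where the condition on `k` is vacuous.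
  rcases min_choice 1 (y ^ 2)⁻¹ with hm | hm <;> rw [hm]
  · rw [one_pow, Real.exp_le_one_iff]
    have : 0 ≤ h * M.Gam φ β * k := by positivity
    linarith
  · have e : ((y ^ 2)⁻¹) ^ 2 = Real.exp (-(4 * Real.log y)) := by
      rw [Real.exp_neg, mul_comm, Real.exp_mul, Real.exp_log hy]
      norm_num [← pow_mul]
    rw [e]
    exact Real.exp_le_exp.2 (by linarith)

end EntropyMDP

/-! ### The actor: mirror descent as an exponential-weights update. -/

namespace EntropyMDP

open InformationTheory

variable {S A : Type*} [MeasurableSpace S] [MeasurableSpace A] {M : EntropyMDP S A}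
  {N : ℕ} {φ : S × A → EuclideanSpace ℝ (Fin N)}

variable (M) in
/-- The exponential-weights update of a log-density. -/
noncomputable def gibbsUpdate (lam : ℝ) (q l : S × A → ℝ) : S × A → ℝ :=
  M.normalise fun p => (1 - M.τ * lam) * l p - lam * q p

theorem isBddMeas_gibbsExponent {q l : S × A → ℝ} (hq : IsBddMeas q) (hl : IsBddMeas l)
    (lam : ℝ) : IsBddMeas fun p => (1 - M.τ * lam) * l p - lam * q p :=
  (hl.const_mul _).sub (hq.const_mul _)

/-- Later estimates use only that `z` depends on the state alone; it is the log partition function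
divided by `lam`. -/
theorem exists_gibbsUpdate_eq (lam : ℝ) (hlam : 0 < lam) (q l : S × A → ℝ) :
    ∃ z : S → ℝ, ∀ p,
      M.gibbsUpdate lam q l p = (1 - M.τ * lam) * l p - lam * q p - lam * z p.1 :=
  ⟨fun s => Real.log (∫ a, Real.exp ((1 - M.τ * lam) * l (s, a) - lam * q (s, a)) ∂M.μ) / lam,
    fun p => by rw [mul_div_cancel₀ _ hlam.ne']; rfl⟩

theorem integral_gibbsUpdate {lam : ℝ} {q l : S × A → ℝ} {z : S → ℝ} (hq : IsBddMeas q)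
    (hl : IsBddMeas l) (hz : ∀ p,
      M.gibbsUpdate lam q l p = (1 - M.τ * lam) * l p - lam * q p - lam * z p.1)
    (s : S) (ν : Measure A) [IsProbabilityMeasure ν] :
    ∫ a, M.gibbsUpdate lam q l (s, a) ∂ν =
      (1 - M.τ * lam) * ∫ a, l (s, a) ∂ν - lam * ∫ a, q (s, a) ∂ν - lam * z s := by
  simp only [hz]
  rw [integral_sub (((section_bdd (isBddMeas_gibbsExponent hq hl lam) s)).integrable ν)
    (integrable_const _), integral_sub (((section_bdd hl s).const_mul _).integrable ν)
    (((section_bdd hq s).const_mul _).integrable ν), integral_const_mul, integral_const_mul]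
  simp

theorem IsLogDensity.integral_approxAdvantage {l : S × A → ℝ} {π : Kernel S A}
    (hπ : M.IsLogDensity l π) (hφ : Measurable φ) (h_bounded : ∀ p, ‖φ p‖ ≤ 1)
    (θ : EuclideanSpace ℝ (Fin N)) (s : S) {ν : Measure A} [IsProbabilityMeasure ν]
    (hν : ν ≪ M.μ) :
    ∫ a, M.approxAdvantage φ θ π s a ∂ν =
      ∫ a, linQ φ θ (s, a) ∂ν + M.τ * ∫ a, l (s, a) ∂ν -
        ∫ a', (linQ φ θ (s, a') + M.τ * llr (π s) M.μ a') ∂(π s) := by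
  have hllr : llr (π s) M.μ =ᵐ[M.μ] fun a => l (s, a) := by
    rw [hπ.eq_tilted]
    exact llr_tilted_self (section_bdd hπ.bdd s) (hπ.integral_exp s)
  have hq := section_bdd (isBddMeas_linQ hφ h_bounded θ) s
  have hl := (section_bdd hπ.bdd s).const_mul M.τ
  rw [← integral_const_mul, ← integral_add (hq.integrable ν) (hl.integrable ν)]
  have h : (fun a => M.approxAdvantage φ θ π s a) =ᵐ[ν] fun a =>
      (linQ φ θ (s, a) + M.τ * l (s, a)) -
        ∫ a', (linQ φ θ (s, a') + M.τ * llr (π s) M.μ a') ∂(π s) := by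
    filter_upwards [hν.ae_le hllr] with a ha
    rw [approxAdvantage, ha]
  rw [integral_congr_ae h, integral_sub ((hq.add hl).integrable ν) (integrable_const _)]
  simp

variable [MeasurableSingletonClass S]

/-- The mirror descent step is the exponential-weights update, at every state. -/
theorem IsLogDensity.isLogDensity_mirrorStep {l : S × A → ℝ} {π πnew : Kernel S A}
    (hπ : M.IsLogDensity l π) (hφ : Measurable φ) (h_bounded : ∀ p, ‖φ p‖ ≤ 1)
    {lam : ℝ} (hlam : 0 < lam) {θ : EuclideanSpace ℝ (Fin N)}
    (hstep : M.IsMirrorStep φ lam θ π πnew) :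
    M.IsLogDensity (M.gibbsUpdate lam (linQ φ θ) l) πnew := by
  obtain ⟨hadm, hmin⟩ := hstep
  obtain ⟨m, hm⟩ := hadm.exists_isLogDensity
  have hq := isBddMeas_linQ hφ h_bounded θ
  set l' := M.gibbsUpdate lam (linQ φ θ) l with hl'
  obtain ⟨z, hz⟩ := exists_gibbsUpdate_eq (M := M) lam hlam (linQ φ θ) l
  have hexp := isBddMeas_gibbsExponent (M := M) hq hπ.bdd lam
  obtain ⟨πh, hπh⟩ := M.exists_kernel_isLogDensity (isBddMeas_normalise (M := M) hexp)
    (integral_exp_normalise hexp)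
  change M.IsLogDensity l' πh at hπh
  have hπM := hπ.isMarkovKernel
  have hπhM := hπh.isMarkovKernel
  have hmM := hm.isMarkovKernel
  set C : S → ℝ := fun s => ∫ a', (linQ φ θ (s, a') + M.τ * llr (π s) M.μ a') ∂(π s) with hC
  -- Completing the divergence: the integrand of the objective is `1/lam` times `KL(η|πh)` plus a
  -- term independent of `η`.
  have hJ : ∀ (η : Kernel S A) (k : S × A → ℝ), M.IsLogDensity k η → ∀ s,
      (∫ a, M.approxAdvantage φ θ π s a ∂(η s)) + 1 / lam * (klDiv (η s) (π s)).toReal =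
        1 / lam * (∫ a, k (s, a) ∂(η s) - ∫ a, l' (s, a) ∂(η s)) + (-z s - C s) := by
    intro η k hη s
    have hηM := hη.isMarkovKernel
    have hkl : (klDiv (η s) (π s)).toReal = ∫ a, k (s, a) ∂(η s) - ∫ a, l (s, a) ∂(η s) := by
      rw [hπ.eq_tilted, toReal_klDiv_tilted (section_bdd hπ.bdd s) (hπ.integral_exp s)
        (hη.klDiv_ne_top s), hη.toReal_klDiv]
    rw [hπ.integral_approxAdvantage hφ h_bounded θ s (klDiv_ne_top_iff.1 (hη.klDiv_ne_top s)).1,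
      hkl, hl', integral_gibbsUpdate hq hπ.bdd hz s (η s)]
    field_simp
    ring
  -- Boundedness of the remainder is read off from `hJ` at `η = π`, where both the divergence and
  -- the mean advantage vanish.
  have hCb : IsBddMeas fun s => -z s - C s := by
    have h1 := fun s => hJ π l hπ s
    have h2 : (fun s => -z s - C s) = fun s =>
        -(1 / lam * (∫ a, l (s, a) ∂(π s) - ∫ a, l' (s, a) ∂(π s))) +
          (∫ a, linQ φ θ (s, a) ∂(π s) + M.τ * ∫ a, l (s, a) ∂(π s) - C s) := by
      funext s
      have h3 := h1 s
      rw [klDiv_self, hπ.integral_approxAdvantage hφ h_bounded θ s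
        (klDiv_ne_top_iff.1 (hπ.klDiv_ne_top s)).1] at h3
      simp only [ENNReal.toReal_zero, mul_zero, add_zero] at h3
      rw [h3]
      ring
    have h4 : C = fun s => ∫ a, linQ φ θ (s, a) ∂(π s) + M.τ * ∫ a, l (s, a) ∂(π s) := by
      funext s
      rw [hC, ← integral_const_mul, ← integral_add ((section_bdd hq s).integrable _)
        (((section_bdd hπ.bdd s).const_mul _).integrable _)]
      refine integral_congr_ae ?_
      have hllr : llr (π s) M.μ =ᵐ[M.μ] fun a => l (s, a) := by
        rw [hπ.eq_tilted]
        exact llr_tilted_self (section_bdd hπ.bdd s) (hπ.integral_exp s)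
      filter_upwards [(klDiv_ne_top_iff.1 (hπ.klDiv_ne_top s)).1.ae_le hllr] with a ha
      rw [ha]
    rw [h2, h4]
    simpa using (((hπ.bdd.integral_kernel_prod π).sub
      (hπh.bdd.integral_kernel_prod π)).const_mul (1 / lam)).neg
  have hKL : ∀ s, (klDiv (πnew s) (πh s)).toReal =
      ∫ a, m (s, a) ∂(πnew s) - ∫ a, l' (s, a) ∂(πnew s) := fun s => by
    rw [hπh.eq_tilted, toReal_klDiv_tilted (section_bdd hπh.bdd s) (hπh.integral_exp s)
      (hm.klDiv_ne_top s), hm.toReal_klDiv]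
  have hKLb : IsBddMeas fun s => (klDiv (πnew s) (πh s)).toReal := by
    simp only [hKL]
    exact (hm.bdd.integral_kernel_prod πnew).sub (hπh.bdd.integral_kernel_prod πnew)
  refine ⟨hπh.bdd, hπh.integral_exp, fun s => ?_⟩
  rw [← hπh.eq_tilted]
  -- Comparison with `πh` from the initial state `s` makes the occupancy integral of `KL(πnew|πh)`
  -- vanish; the occupancy measure charges `s`.
  have h1 := hmin (Measure.dirac s) inferInstance πh hπh.isAdmissible
  unfold mirrorObjective at h1
  simp only [hJ πh l' hπh, hJ πnew m hm, ← hKL, sub_self, mul_zero, zero_add] at h1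
  rw [integral_add ((hKLb.const_mul _).integrable _) (hCb.integrable _), integral_const_mul] at h1
  have h2 : ∫ s', (klDiv (πnew s') (πh s')).toReal ∂(M.stateOccupancy π (Measure.dirac s)) = 0 := by
    refine le_antisymm ?_ (integral_nonneg fun _ => ENNReal.toReal_nonneg)
    have : 0 < 1 / lam := by positivity
    by_contra hcon
    have := mul_pos this (not_le.1 hcon)
    linarith
  rw [integral_eq_zero_iff_of_nonneg (fun _ => ENNReal.toReal_nonneg) (hKLb.integrable _)] at h2
  have h3 : ∀ᵐ s' ∂(Measure.dirac s), (klDiv (πnew s') (πh s')).toReal = 0 :=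
    (absolutelyContinuous_occupancy M.γ_pos M.γ_lt_one (M.stateKernel π)
      (Measure.dirac s)).ae_le h2
  rw [ae_dirac_eq] at h3
  have h4 : (klDiv (πnew s) (πh s)).toReal = 0 := h3
  -- Needed because `toReal` also sends `∞` to `0`.
  have h5 : klDiv (πnew s) (πh s) ≠ ∞ := by
    rw [hπh.eq_tilted]
    exact klDiv_tilted_ne_top (section_bdd hπh.bdd s) (hm.klDiv_ne_top s)
  exact klDiv_eq_zero_iff.1 (((ENNReal.toReal_eq_zero_iff _).1 h4).resolve_right h5)

end EntropyMDP

/-! ### Two elementary inequalities. -/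

/-- Take `C` to be the supremum and solve for it; finiteness of the supremum is what permits this.
-/
theorem le_div_of_forall_le_add_mul {X : Type*} {w : X → ℝ} {b γ : ℝ} (hγ : γ < 1)
    (hw : BddAbove (Set.range w)) (h : ∀ C, (∀ x, w x ≤ C) → ∀ x, w x ≤ b + γ * C) (x : X) :
    w x ≤ b / (1 - γ) := by
  have : Nonempty X := ⟨x⟩
  have h1 : ⨆ y, w y ≤ b + γ * ⨆ y, w y := ciSup_le (h _ fun y => le_ciSup hw y)
  refine (le_ciSup hw x).trans ?_
  rw [le_div_iff₀ (by linarith)]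
  linarith

/-- A discrete Grönwall inequality with summable coefficients. -/
theorem exists_sum_le_of_le_mul {e c : ℕ → ℝ} {α₀ α₁ : ℝ} (hα₀ : 0 ≤ α₀) (hα₁ : 0 < α₁)
    (he : ∀ n, 0 ≤ e n) (hc : ∀ n, 0 ≤ c n) (hs : Summable c)
    (h : ∀ n, e n ≤ c n * (α₀ + α₁ * ∑ i ∈ Finset.range n, e i)) :
    ∃ C, 0 ≤ C ∧ ∀ n, ∑ i ∈ Finset.range n, e i ≤ C := by
  have hY : ∀ n, α₀ + α₁ * ∑ i ∈ Finset.range n, e i ≤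
      α₀ * Real.exp (α₁ * ∑ i ∈ Finset.range n, c i) := by
    intro n
    induction n with
    | zero => simp
    | succ n ih =>
      rw [Finset.sum_range_succ, Finset.sum_range_succ, mul_add α₁ _ (c n), Real.exp_add,
        ← mul_assoc]
      have hpos : 0 ≤ α₀ + α₁ * ∑ i ∈ Finset.range n, e i :=
        add_nonneg hα₀ (mul_nonneg hα₁.le (Finset.sum_nonneg fun i _ => he i))
      calc α₀ + α₁ * (∑ i ∈ Finset.range n, e i + e n)
          = (α₀ + α₁ * ∑ i ∈ Finset.range n, e i) + α₁ * e n := by ring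
        _ ≤ (α₀ + α₁ * ∑ i ∈ Finset.range n, e i) +
            α₁ * (c n * (α₀ + α₁ * ∑ i ∈ Finset.range n, e i)) := by gcongr; exact h n
        _ = (α₀ + α₁ * ∑ i ∈ Finset.range n, e i) * (α₁ * c n + 1) := by ring
        _ ≤ (α₀ + α₁ * ∑ i ∈ Finset.range n, e i) * Real.exp (α₁ * c n) :=
            mul_le_mul_of_nonneg_left (Real.add_one_le_exp _) hpos
        _ ≤ _ := mul_le_mul_of_nonneg_right ih (Real.exp_pos _).le
  refine ⟨α₀ * Real.exp (α₁ * ∑' i, c i) / α₁, by positivity, fun n => ?_⟩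
  rw [le_div_iff₀ hα₁]
  have h1 : α₀ * Real.exp (α₁ * ∑ i ∈ Finset.range n, c i) ≤ α₀ * Real.exp (α₁ * ∑' i, c i) := by
    gcongr
    exact hs.sum_le_tsum _ fun i _ => hc i
  have := hY n
  linarith

/-! ### Approximate policy improvement. -/

namespace EntropyMDP

open InformationTheory

theorem abs_integral_sub_le {A : Type*} [MeasurableSpace A] {f g : A → ℝ} (hf : IsBddMeas f)
    (hg : IsBddMeas g) {e : ℝ} (h : ∀ a, |f a - g a| ≤ e) (ν : Measure A)
    [IsProbabilityMeasure ν] : |∫ a, f a ∂ν - ∫ a, g a ∂ν| ≤ e := by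
  rw [← integral_sub (hf.integrable ν) (hg.integrable ν)]
  exact IsBddMeas.abs_integral_le h ν

theorem integral_le_of_forall_le {X : Type*} [MeasurableSpace X] {f : X → ℝ} (hf : IsBddMeas f)
    {C : ℝ} (h : ∀ x, f x ≤ C) (ν : Measure X) [IsProbabilityMeasure ν] : ∫ x, f x ∂ν ≤ C := by
  simpa using integral_mono (hf.integrable ν) (integrable_const C) h

variable {S A : Type*} [MeasurableSpace S] [MeasurableSpace A] {M : EntropyMDP S A}
  [MeasurableSpace.CountableOrCountablyGenerated S A] [MeasurableSingletonClass S]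

/-- Only costs can be negative, since KL is nonnegative; hence the bound is uniform over policies.
-/
theorem IsLogDensity.neg_realValue_le {l : S × A → ℝ} {π : Kernel S A} (h : M.IsLogDensity l π)
    {B : ℝ} (hB : ∀ p, |M.cost p| ≤ B) (s : S) : -M.realValue π s ≤ B / (1 - M.γ) := by
  have := h.isMarkovKernel
  have hV := h.isBddMeas_realValue
  refine le_div_of_forall_le_add_mul (w := fun s => -M.realValue π s) M.γ_lt_one ?_ ?_ s
  · obtain ⟨D, hD⟩ := hV.2
    refine ⟨D, ?_⟩
    rintro _ ⟨s, rfl⟩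
    exact (neg_le_abs _).trans (hD s)
  · intro C hC s
    have h1 := integral_le_of_forall_le (section_bdd (isBddMeas_actionValue (M := M) hV).neg s)
      (C := B + M.γ * C) (fun a => by
        have h2 := integral_le_of_forall_le hV.neg hC (M.P (s, a))
        rw [integral_neg] at h2
        have h3 := mul_le_mul_of_nonneg_left h2 M.γ_pos.le
        have h4 := (abs_le.1 (hB (s, a))).1
        unfold actionValue
        linarith) (π s)
    rw [integral_neg] at h1
    rw [h.isBddMeas_realValue_and_bellman.2 s]
    have := mul_nonneg M.τ_pos.le (ENNReal.toReal_nonneg (a := klDiv (π s) M.μ))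
    linarith

section Improvement

variable {l q : S × A → ℝ} {π π' : Kernel S A} {lam e : ℝ}

/-- Up to `e`, the number `-z s` separates the one-step cost of `π'` from the value of `π`.
Integrate the update formula over `π'` and over `π`, and apply the Gibbs inequality to the other
policy's log-density; the first case needs `1 - τ lam ≥ 0`. -/
theorem IsLogDensity.mirrorStep_residual_le (hπ : M.IsLogDensity l π)
    (hπ' : M.IsLogDensity (M.gibbsUpdate lam q l) π') (hq : IsBddMeas q) (hlam : 0 < lam)
    (hτlam : M.τ * lam < 1) (he : ∀ p, |q p - M.actionValue (M.realValue π) p| ≤ e) {z : S → ℝ}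
    (hz : ∀ p, M.gibbsUpdate lam q l p = (1 - M.τ * lam) * l p - lam * q p - lam * z p.1)
    (s : S) :
    ∫ a, M.actionValue (M.realValue π) (s, a) ∂(π' s) +
      M.τ * ∫ a, M.gibbsUpdate lam q l (s, a) ∂(π' s) ≤ e - z s ∧
    -z s - e ≤ M.realValue π s := by
  have := hπ.isMarkovKernel
  have := hπ'.isMarkovKernel
  have hQ := section_bdd (isBddMeas_actionValue (M := M) hπ.isBddMeas_realValue) s
  have hqs := section_bdd hq s
  have h1 := abs_le.1 (abs_integral_sub_le hqs hQ (fun a => he (s, a)) (π' s))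
  have h2 := abs_le.1 (abs_integral_sub_le hqs hQ (fun a => he (s, a)) (π s))
  have h3 := integral_gibbsUpdate hq hπ.bdd hz s (π' s)
  have h4 := integral_gibbsUpdate hq hπ.bdd hz s (π s)
  have h5 := hπ.integral_le s (hπ'.klDiv_ne_top s)
  rw [hπ'.toReal_klDiv] at h5
  have h6 := hπ'.integral_le s (hπ.klDiv_ne_top s)
  rw [hπ.toReal_klDiv] at h6
  have h7 := hπ.realValue_eq s
  constructor
  · refine le_of_mul_le_mul_left ?_ hlam
    have h8 := mul_le_mul_of_nonneg_left h1.1 hlam.le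
    have h9 := mul_le_mul_of_nonneg_left h5 (by linarith : 0 ≤ 1 - M.τ * lam)
    linarith
  · refine le_of_mul_le_mul_left ?_ hlam
    have h8 := mul_le_mul_of_nonneg_left h2.2 hlam.le
    rw [h7]
    linarith

theorem IsLogDensity.realValue_sub_le_add (hπ : M.IsLogDensity l π) {l' : S × A → ℝ}
    (hπ' : M.IsLogDensity l' π') {C : ℝ}
    (hC : ∀ s, M.realValue π' s - M.realValue π s ≤ C) (s : S) :
    M.realValue π' s ≤ ∫ a, M.actionValue (M.realValue π) (s, a) ∂(π' s) +
      M.τ * ∫ a, l' (s, a) ∂(π' s) + M.γ * C := by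
  have := hπ'.isMarkovKernel
  have hV := hπ.isBddMeas_realValue
  have hV' := hπ'.isBddMeas_realValue
  have hQ := section_bdd (isBddMeas_actionValue (M := M) hV) s
  have hQ' := section_bdd (isBddMeas_actionValue (M := M) hV') s
  have h1 := integral_le_of_forall_le (hQ'.sub hQ) (C := M.γ * C) (fun a => by
    have h2 := integral_le_of_forall_le (hV'.sub hV) hC (M.P (s, a))
    rw [integral_sub (hV'.integrable _) (hV.integrable _)] at h2
    have h3 := mul_le_mul_of_nonneg_left h2 M.γ_pos.le
    unfold actionValue
    linarith) (π' s)
  rw [integral_sub (hQ'.integrable _) (hQ.integrable _)] at h1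
  rw [hπ'.realValue_eq s]
  linarith

/-- Approximate policy improvement. -/
theorem IsLogDensity.realValue_mirrorStep_le (hπ : M.IsLogDensity l π)
    (hπ' : M.IsLogDensity (M.gibbsUpdate lam q l) π') (hq : IsBddMeas q) (hlam : 0 < lam)
    (hτlam : M.τ * lam < 1) (he : ∀ p, |q p - M.actionValue (M.realValue π) p| ≤ e) (s : S) :
    M.realValue π' s - M.realValue π s ≤ 2 * e / (1 - M.γ) := by
  obtain ⟨z, hz⟩ := exists_gibbsUpdate_eq (M := M) lam hlam q l
  refine le_div_of_forall_le_add_mul (w := fun s => M.realValue π' s - M.realValue π s)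
    M.γ_lt_one ?_ ?_ s
  · obtain ⟨D, hD⟩ := (hπ'.isBddMeas_realValue.sub hπ.isBddMeas_realValue).2
    refine ⟨D, ?_⟩
    rintro _ ⟨s, rfl⟩
    exact (le_abs_self _).trans (hD s)
  · intro C hC s
    have h1 := hπ.mirrorStep_residual_le hπ' hq hlam hτlam he hz s
    have h2 := hπ.realValue_sub_le_add hπ' hC s
    linarith [h1.1, h1.2]

/-- The one-step suboptimality bound of approximate mirror descent against a comparison
distribution `ν` on the actions. -/
theorem IsLogDensity.realValue_sub_le_of_mirrorStep (hπ : M.IsLogDensity l π)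
    (hπ' : M.IsLogDensity (M.gibbsUpdate lam q l) π') (hq : IsBddMeas q) (hlam : 0 < lam)
    (hτlam : M.τ * lam < 1) (he : ∀ p, |q p - M.actionValue (M.realValue π) p| ≤ e) (s : S)
    {ν : Measure A} [IsProbabilityMeasure ν] (hν : klDiv ν M.μ ≠ ∞) :
    M.realValue π s - (∫ a, M.actionValue (M.realValue π) (s, a) ∂ν
        + M.τ * (klDiv ν M.μ).toReal) ≤
      M.realValue π s - M.realValue π' s +
        1 / lam * (∫ a, M.gibbsUpdate lam q l (s, a) ∂ν - ∫ a, l (s, a) ∂ν) +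
        2 * e / (1 - M.γ) := by
  obtain ⟨z, hz⟩ := exists_gibbsUpdate_eq (M := M) lam hlam q l
  have hQ := section_bdd (isBddMeas_actionValue (M := M) hπ.isBddMeas_realValue) s
  have h1 := (hπ.mirrorStep_residual_le hπ' hq hlam hτlam he hz s).1
  have h2 := hπ.realValue_sub_le_add hπ'
    (hπ.realValue_mirrorStep_le hπ' hq hlam hτlam he) s
  have h3 := (abs_le.1 (abs_integral_sub_le (section_bdd hq s) hQ (fun a => he (s, a)) ν)).2
  have h4 := integral_gibbsUpdate hq hπ.bdd hz s ν
  have h5 := mul_le_mul_of_nonneg_left (hπ.integral_le s hν) M.τ_pos.le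
  -- The error budget: `e` for replacing `Q` by `q` under `ν`, `e` under `π'`, and the discounted
  -- policy improvement loss. The normaliser `z` cancels between `h1` and `h7`.
  have h6 : 2 * e / (1 - M.γ) = 2 * e + M.γ * (2 * e / (1 - M.γ)) := by
    have : 1 - M.γ ≠ 0 := by linarith [M.γ_lt_one]
    field_simp
    ring
  have h7 : 1 / lam * (∫ a, M.gibbsUpdate lam q l (s, a) ∂ν - ∫ a, l (s, a) ∂ν) =
      -M.τ * ∫ a, l (s, a) ∂ν - ∫ a, q (s, a) ∂ν - z s := by
    rw [h4]
    field_simp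
    ring
  rw [h6, h7]
  linarith

end Improvement

end EntropyMDP

/-! ### Regret of the actor and summability of the critic errors. -/

namespace EntropyMDP

open InformationTheory

variable {S A : Type*} [MeasurableSpace S] [MeasurableSpace A] {M : EntropyMDP S A}
  [MeasurableSpace.CountableOrCountablyGenerated S A] [MeasurableSingletonClass S]

/-- The averaged regret of approximate mirror descent with summable evaluation errors. -/
theorem exists_sum_valueAt_sub_le {lam : ℝ} (hlam : 0 < lam) (hτlam : M.τ * lam < 1)
    {l q : ℕ → S × A → ℝ} {π : ℕ → Kernel S A} {e : ℕ → ℝ}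
    (hπ : ∀ n, M.IsLogDensity (l n) (π n)) (hq : ∀ n, IsBddMeas (q n))
    (hl : ∀ n, l (n + 1) = M.gibbsUpdate lam (q n) (l n))
    (he : ∀ n p, |q n p - M.actionValue (M.realValue (π n)) p| ≤ e n)
    {C : ℝ} (hC : ∀ n, ∑ i ∈ Finset.range n, e i ≤ C) :
    ∃ a, 0 ≤ a ∧ ∀ (ρ : Measure S) [IsProbabilityMeasure ρ] (πs : Kernel S A),
      M.IsOptimalPolicy ρ πs → ∃ v : ℝ, M.valueAt πs ρ = v ∧
        ∀ n, ∑ r ∈ Finset.range n, (∫ s, M.realValue (π r) s ∂ρ - v) ≤ a := by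
  have hγ : 0 < 1 - M.γ := by linarith [M.γ_lt_one]
  have hτ := M.τ_pos
  have hV := fun n => (hπ n).isBddMeas_realValue
  obtain ⟨B, hB⟩ := M.bounded_cost
  obtain ⟨b, hb⟩ := (hV 0).2
  obtain ⟨L, hL⟩ := (hπ 0).bdd.2
  -- The terms bound, in order: the first value, minus the last value, the entropy of the optimal
  -- policy, the initial log-density, and the total error. None depends on `ρ` or `πs`.
  set a := (b + B / (1 - M.γ) + 1 / lam * ((b + B) / M.τ + L) + 2 * C / (1 - M.γ)) / (1 - M.γ)
    with ha
  refine ⟨max a 0, le_max_right _ _, fun ρ hρ πs hopt => ?_⟩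
  obtain ⟨hπs, hopt⟩ := hopt
  have hv0 : M.optimalValue ρ ≤ M.valueAt (π 0) ρ := iInf₂_le (π 0) (hπ 0).isMarkovKernel
  have htop : M.valueAt πs ρ ≠ ⊤ := by
    rw [hopt]
    exact ne_top_of_le_ne_top ((hπ 0).valueAt_ne_top ρ) hv0
  obtain ⟨v, hv, hint, hae, hd⟩ := exists_valueAt_eq πs ρ htop
  refine ⟨v, hv, fun n => ?_⟩
  set d := M.stateOccupancy πs ρ with hdd
  have hvb : v ≤ ∫ s, M.realValue (π 0) s ∂ρ := by
    rw [← hopt, hv, (hπ 0).valueAt_eq ρ] at hv0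
    exact_mod_cast hv0
  obtain ⟨s₀⟩ := nonempty_of_isProbabilityMeasure ρ
  have hb0 : 0 ≤ b := (abs_nonneg _).trans (hb s₀)
  have hvb' : (1 - M.γ) * v ≤ b := by
    have h1 := hvb.trans (abs_le.1 (IsBddMeas.abs_integral_le hb ρ)).2
    nlinarith [M.γ_pos]
  set k : S → ℝ := fun s => (klDiv (πs s) M.μ).toReal with hk
  -- The identity with `W = 0` bounds the entropy of an optimal policy by its value, which is at
  -- most that of `π 0`.
  have hkb : ∫ s, k s ∂d ≤ (b + B) / M.τ := by
    have h1 := hd (fun _ => 0) (IsBddMeas.const 0)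
    have h2 : IsBddMeas fun s => ∫ a, M.actionValue (fun _ => 0) (s, a) ∂(πs s) :=
      (isBddMeas_actionValue (IsBddMeas.const 0)).integral_kernel_prod πs
    simp only [integral_zero, sub_zero] at h1
    rw [integral_add (h2.integrable d) (hint.const_mul _), integral_const_mul] at h1
    have h3 := (abs_le.1 (IsBddMeas.abs_integral_le (B := B)
      (f := fun s => ∫ a, M.actionValue (fun _ => 0) (s, a) ∂(πs s)) (fun s =>
      IsBddMeas.abs_integral_le (fun a => by simpa [actionValue] using hB (s, a)) (πs s)) d)).1
    rw [le_div_iff₀ hτ]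
    linarith
  set m : ℕ → S → ℝ := fun r s => ∫ a, l r (s, a) ∂(πs s) with hm
  have hmb : ∀ r, IsBddMeas (m r) := fun r => (hπ r).bdd.integral_kernel_prod πs
  have hstep : ∀ r, (1 - M.γ) * (∫ s, M.realValue (π r) s ∂ρ - v) ≤
      (∫ s, M.realValue (π r) s ∂d - ∫ s, M.realValue (π (r + 1)) s ∂d) +
        1 / lam * (∫ s, m (r + 1) s ∂d - ∫ s, m r s ∂d) + 2 / (1 - M.γ) * e r := by
    intro r
    have hW := hV r
    have hg : IsBddMeas fun s => M.realValue (π r) s - M.realValue (π (r + 1)) s +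
        1 / lam * (m (r + 1) s - m r s) + 2 * e r / (1 - M.γ) :=
      ((hW.sub (hV (r + 1))).add (((hmb (r + 1)).sub (hmb r)).const_mul _)).add
        (IsBddMeas.const _)
    have hQ : IsBddMeas fun s => ∫ a, M.actionValue (M.realValue (π r)) (s, a) ∂(πs s) :=
      (isBddMeas_actionValue hW).integral_kernel_prod πs
    have h1 : -∫ s, (∫ a, M.actionValue (M.realValue (π r)) (s, a) ∂(πs s) + M.τ * k s -
        M.realValue (π r) s) ∂d ≤ ∫ s, (M.realValue (π r) s - M.realValue (π (r + 1)) s +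
        1 / lam * (m (r + 1) s - m r s) + 2 * e r / (1 - M.γ)) ∂d := by
      rw [← integral_neg]
      refine integral_mono_ae
        (((hQ.integrable d).add (hint.const_mul M.τ)).sub (hW.integrable d)).neg
        (hg.integrable d) ?_
      -- An arbitrary optimal policy may have infinite divergence on an occupancy-null set of
      -- states.
      filter_upwards [hae] with s hs
      have hπ' := hπ (r + 1)
      rw [hl r] at hπ'
      have h2 := (hπ r).realValue_sub_le_of_mirrorStep hπ' (hq r) hlam hτlam (he r) s hs
      simp only [hm, hk, hl r]
      linarith
    rw [← hd _ hW, integral_add (((hW.sub (hV (r + 1))).add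
        (((hmb (r + 1)).sub (hmb r)).const_mul _)).integrable d) (integrable_const _),
      integral_add ((hW.sub (hV (r + 1))).integrable d)
        ((((hmb (r + 1)).sub (hmb r)).const_mul _).integrable d), integral_const_mul,
      integral_sub (hW.integrable d) ((hV (r + 1)).integrable d),
      integral_sub ((hmb (r + 1)).integrable d) ((hmb r).integrable d)] at h1
    simp only [integral_const, probReal_univ, one_smul] at h1
    have e1 : 2 * e r / (1 - M.γ) = 2 / (1 - M.γ) * e r := by ring
    rw [e1] at h1
    linarith
  have hsum := Finset.sum_le_sum fun r (_ : r ∈ Finset.range n) => hstep r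
  rw [← Finset.mul_sum, Finset.sum_add_distrib, Finset.sum_add_distrib, ← Finset.mul_sum,
    ← Finset.mul_sum, Finset.sum_range_sub',
    Finset.sum_range_sub fun r => ∫ s, m r s ∂d] at hsum
  refine le_trans ?_ (le_max_left _ _)
  rw [ha, le_div_iff₀ hγ, mul_comm]
  refine hsum.trans ?_
  have h0 := (abs_le.1 (IsBddMeas.abs_integral_le hb d)).2
  have h1 := integral_le_of_forall_le (hV n).neg ((hπ n).neg_realValue_le hB) d
  rw [integral_neg] at h1
  have h2 : ∫ s, m n s ∂d ≤ ∫ s, k s ∂d := by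
    refine integral_mono_ae ((hmb n).integrable d) hint ?_
    filter_upwards [hae] with s hs
    exact (hπ n).integral_le s hs
  have h3 := (abs_le.1 (IsBddMeas.abs_integral_le (f := m 0)
    (fun s => IsBddMeas.abs_integral_le (fun a => hL (s, a)) (πs s)) d)).1
  have h4 : 1 / lam * (∫ s, m n s ∂d - ∫ s, m 0 s ∂d) ≤ 1 / lam * ((b + B) / M.τ + L) :=
    mul_le_mul_of_nonneg_left (by linarith) (by positivity)
  have h5 : 2 / (1 - M.γ) * ∑ i ∈ Finset.range n, e i ≤ 2 * C / (1 - M.γ) := by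
    rw [mul_div_right_comm]
    exact mul_le_mul_of_nonneg_left (hC n) (by positivity)
  linarith

/-- Iterated approximate improvement: the growth of the values is controlled by past errors only, as
the Grönwall argument requires. -/
theorem realValue_le_of_mirrorSteps {lam : ℝ} (hlam : 0 < lam) (hτlam : M.τ * lam < 1)
    {l q : ℕ → S × A → ℝ} {π : ℕ → Kernel S A} {e : ℕ → ℝ}
    (hπ : ∀ n, M.IsLogDensity (l n) (π n)) (hq : ∀ n, IsBddMeas (q n))
    (hl : ∀ n, l (n + 1) = M.gibbsUpdate lam (q n) (l n))
    (he : ∀ n p, |q n p - M.actionValue (M.realValue (π n)) p| ≤ e n) {b : ℝ}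
    (hb : ∀ s, M.realValue (π 0) s ≤ b) (n : ℕ) (s : S) :
    M.realValue (π n) s ≤ b + 2 / (1 - M.γ) * ∑ i ∈ Finset.range n, e i := by
  induction n with
  | zero => simpa using hb s
  | succ n ih =>
    have hπ' := hπ (n + 1)
    rw [hl n] at hπ'
    have h := (hπ n).realValue_mirrorStep_le hπ' (hq n) hlam hτlam (he n) s
    have e1 : 2 * e n / (1 - M.γ) = 2 / (1 - M.γ) * e n := by ring
    rw [Finset.sum_range_succ, mul_add]
    linarith

variable {N : ℕ} {φ : S × A → EuclideanSpace ℝ (Fin N)}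

/-- The log-densities generated by the double loop algorithm. -/
noncomputable def logDensities (M : EntropyMDP S A) (φ : S × A → EuclideanSpace ℝ (Fin N))
    (lam : ℝ) (θ : ℕ → EuclideanSpace ℝ (Fin N)) (l₀ : S × A → ℝ) : ℕ → S × A → ℝ
  | 0 => l₀
  | n + 1 => M.gibbsUpdate lam (linQ φ (θ (n + 1))) (logDensities M φ lam θ l₀ n)

theorem summable_min_inv_sq {κ : ℝ} (hκ : 0 < κ) :
    Summable fun n : ℕ => min 1 ((κ * ((n : ℝ) + 1)) ^ 2)⁻¹ := by
  have h := ((summable_nat_add_iff 1).2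
    (Real.summable_nat_pow_inv.2 (one_lt_two : 1 < 2))).mul_left (κ ^ 2)⁻¹
  refine Summable.of_nonneg_of_le (fun n => by positivity) (fun n => min_le_right _ _) ?_
  refine h.congr fun n => ?_
  push_cast
  rw [mul_pow, mul_inv]

/-- The evaluation errors of the critic are summable. -/
theorem exists_sum_norm_sub_le (hφ : Measurable φ) (h_bounded : ∀ p, ‖φ p‖ ≤ 1)
    (β : Measure (S × A)) [IsProbabilityMeasure β] (hmin : 0 < minEigenvalue φ β)
    {lam h κ : ℝ} (hlam : 0 < lam) (hτlam : M.τ * lam < 1) (hh : 0 < h)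
    (hh' : h < M.Gam φ β / (2 * (1 + M.γ))) (hκ : 0 < κ) {K : ℕ → ℕ}
    (hK : ∀ n : ℕ, 4 / (h * M.Gam φ β) * Real.log (κ * ((n : ℝ) + 1)) ≤ (K n : ℝ))
    {θ θs : ℕ → EuclideanSpace ℝ (Fin N)} {π : ℕ → Kernel S A} {l : ℕ → S × A → ℝ}
    (hπ : ∀ n, M.IsLogDensity (l n) (π n))
    (hl : ∀ n, l (n + 1) = M.gibbsUpdate lam (linQ φ (θ (n + 1))) (l n))
    (hθs : ∀ n p, M.qValue (π n) p = linQ φ (θs n) p)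
    (hcritic : ∀ n,
      θ (n + 1) = (fun ϑ => ϑ - h • M.semiGradient φ β ϑ (π n))^[K n] (θ n)) :
    ∃ C, 0 ≤ C ∧ ∀ n, ∑ i ∈ Finset.range n, ‖θ (i + 1) - θs i‖ ≤ C := by
  have hγ : 0 < 1 - M.γ := by linarith [M.γ_lt_one]
  set e : ℕ → ℝ := fun i => ‖θ (i + 1) - θs i‖ with he
  set c : ℕ → ℝ := fun n => min 1 ((κ * ((n : ℝ) + 1)) ^ 2)⁻¹ with hc
  have hcontr : ∀ n, e n ≤ c n * ‖θ n - θs n‖ := by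
    intro n
    simp only [he, hcritic n]
    exact (hπ n).norm_td_iterate_le hφ h_bounded β hh hh' (hθs n) (θ n) (by positivity) (hK n)
  have heQ : ∀ n p, |linQ φ (θ (n + 1)) p - M.actionValue (M.realValue (π n)) p| ≤ e n := by
    intro n p
    rw [← qValue_eq, hθs n, ← linQ_sub]
    exact abs_linQ_le h_bounded _ p
  obtain ⟨B, hB⟩ := M.bounded_cost
  obtain ⟨b, hb⟩ := (hπ 0).isBddMeas_realValue.2
  obtain ⟨s₀, a₀⟩ := nonempty_of_isProbabilityMeasure β
  have hb0 : 0 ≤ b := (abs_nonneg _).trans (hb s₀)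
  have hB0 : 0 ≤ B := (abs_nonneg _).trans (hB (s₀, a₀))
  have he0 : ∀ n, 0 ≤ e n := fun n => norm_nonneg _
  have hE0 : ∀ n, 0 ≤ ∑ i ∈ Finset.range n, e i := fun n => Finset.sum_nonneg fun i _ => he0 i
  have hVb := realValue_le_of_mirrorSteps hlam hτlam hπ
    (fun n => isBddMeas_linQ hφ h_bounded (θ (n + 1))) hl heQ
    (fun s => (le_abs_self _).trans (hb s))
  -- An a priori bound on `|Q^{π n}|`, affine in the errors made before step `n`.
  set R : ℕ → ℝ := fun n =>
    (B + B / (1 - M.γ) + b + 2 / (1 - M.γ) * ∑ i ∈ Finset.range n, e i) with hR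
  have hR0 : ∀ n, 0 ≤ R n := fun n => by
    have := hE0 n
    simp only [hR]
    positivity
  set σ := √(minEigenvalue φ β) with hσ
  have hσ0 : 0 < σ := Real.sqrt_pos.2 hmin
  have hθsb : ∀ n, ‖θs n‖ ≤ R n / σ := by
    intro n
    refine norm_le_of_abs_linQ_le hφ h_bounded β hmin (hR0 n) fun p => ?_
    rw [← hθs n, qValue_eq]
    have h1 : ∀ s, |M.realValue (π n) s| ≤ R n - B := by
      intro s
      have h2 := hVb n s
      have h3 := (hπ n).neg_realValue_le hB s
      have h4 : 0 ≤ B / (1 - M.γ) := by positivity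
      have h5 : 0 ≤ 2 / (1 - M.γ) * ∑ i ∈ Finset.range n, e i := mul_nonneg (by positivity) (hE0 n)
      simp only [hR]
      exact abs_le.2 ⟨by linarith, by linarith⟩
    have h6 := IsBddMeas.abs_integral_le h1 (M.P p)
    have h7 : |M.γ * ∫ s', M.realValue (π n) s' ∂(M.P p)| ≤ R n - B := by
      rw [abs_mul, abs_of_pos M.γ_pos]
      exact (mul_le_of_le_one_left (abs_nonneg _) M.γ_lt_one.le).trans h6
    refine (abs_add_le _ _).trans ?_
    linarith [hB p]
  set α₀ := ‖θ 0 - θs 0‖ + 2 * (B + B / (1 - M.γ) + b) / σ with hα₀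
  set α₁ := 1 + 2 * (2 / (1 - M.γ)) / σ with hα₁
  refine exists_sum_le_of_le_mul (c := c) (α₀ := α₀) (α₁ := α₁) (by positivity) (by positivity) he0
    (fun n => by positivity) (summable_min_inv_sq hκ) fun n => ?_
  refine (hcontr n).trans (mul_le_mul_of_nonneg_left ?_ (by positivity))
  -- At `n = 0` the distance is absorbed by `α₀`. Later, the warm start `θ (n + 1)` is within `e n`
  -- of the previous target, so the new distance is at most `e n` plus the norms of both targets.
  cases n with
  | zero =>
    have : 0 ≤ 2 * (B + B / (1 - M.γ) + b) / σ := by positivity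
    simp only [Finset.range_zero, Finset.sum_empty, mul_zero, add_zero, hα₀]
    linarith
  | succ n =>
    have h1 : ‖θ (n + 1) - θs (n + 1)‖ ≤ e n + ‖θs n‖ + ‖θs (n + 1)‖ := by
      have : θ (n + 1) - θs (n + 1) = (θ (n + 1) - θs n) + θs n - θs (n + 1) := by abel
      rw [this]
      exact (norm_sub_le _ _).trans (add_le_add (norm_add_le _ _) le_rfl)
    have h2 : R n ≤ R (n + 1) := by
      simp only [hR, Finset.sum_range_succ, mul_add]
      have : 0 ≤ 2 / (1 - M.γ) * e n := mul_nonneg (by positivity) (he0 n)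
      linarith
    have h3 : R n / σ ≤ R (n + 1) / σ := by gcongr
    have h4 : e n ≤ ∑ i ∈ Finset.range (n + 1), e i := by
      rw [Finset.sum_range_succ]
      linarith [hE0 n]
    have h5 : 2 * (R (n + 1) / σ) = 2 * (B + B / (1 - M.γ) + b) / σ +
        2 * (2 / (1 - M.γ)) / σ * ∑ i ∈ Finset.range (n + 1), e i := by
      simp only [hR]
      ring
    have h6 := norm_nonneg (θ 0 - θs 0)
    have h7 := hθsb n
    have h8 := hθsb (n + 1)
    rw [hα₀, hα₁, add_mul, one_mul]
    linarith

end EntropyMDP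

/-! ### Assembly of the main theorem. -/

theorem mainTheorem2 {S A : Type*}
    [TopologicalSpace S] [PolishSpace S] [MeasurableSpace S] [BorelSpace S]
    [TopologicalSpace A] [PolishSpace A] [MeasurableSpace A] [BorelSpace A]
    (M : EntropyMDP S A)
    {N : ℕ} (φ : S × A → EuclideanSpace ℝ (Fin N)) (hφ : Measurable φ)
    (β : Measure (S × A)) [IsProbabilityMeasure β]
    (h_realisable : M.Realisable φ)
    (h_eigenvalue : 0 < EntropyMDP.minEigenvalue φ β)
    (h_bounded : ∀ p, ‖φ p‖ ≤ 1)
    (lam h κ : ℝ) (hlam : 0 < lam) (hτlam : M.τ * lam < 1)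
    (hh : 0 < h) (hh' : h < M.Gam φ β / (2 * (1 + M.γ)))
    (hκ : 0 < κ)
    (K : ℕ → ℕ) (hK : ∀ n : ℕ, 4 / (h * M.Gam φ β) * Real.log (κ * ((n : ℝ) + 1)) ≤ (K n : ℝ))
    (θ : ℕ → EuclideanSpace ℝ (Fin N)) (π : ℕ → Kernel S A)
    (h_iterates : M.IsDoubleLoop φ β h lam K θ π) :
    ∃ a : ℝ, 0 ≤ a ∧ ∀ ρ : Measure S, IsProbabilityMeasure ρ →
      (∃ πstar : Kernel S A, M.IsOptimalPolicy ρ πstar) ∧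
      ∀ πstar : Kernel S A, M.IsOptimalPolicy ρ πstar →
        ∀ n : ℕ, 1 ≤ n →
          (⨅ r : Fin n, M.valueAt (π r) ρ) - M.valueAt πstar ρ ≤ ((a / (n : ℝ) : ℝ) : EReal) := by
  obtain ⟨l₀, hl₀⟩ := h_iterates.initial.exists_isLogDensity
  set l := EntropyMDP.logDensities M φ lam θ l₀ with hl
  have hπ : ∀ n, M.IsLogDensity (l n) (π n) := by
    intro n
    induction n with
    | zero => exact hl₀
    | succ n ih => exact ih.isLogDensity_mirrorStep hφ h_bounded hlam (h_iterates.actor n)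
  choose θs hθs using fun n => h_realisable (π n) (hπ n).isAdmissible
  obtain ⟨C, -, hC⟩ := EntropyMDP.exists_sum_norm_sub_le hφ h_bounded β h_eigenvalue hlam hτlam hh
    hh' hκ hK hπ (fun n => rfl) hθs h_iterates.critic
  -- The estimate of `Q^{π n}` is the one with parameter `θ (n + 1)`, since the critic runs before
  -- the actor.
  obtain ⟨a, ha, hreg⟩ := EntropyMDP.exists_sum_valueAt_sub_le hlam hτlam hπ
    (fun n => EntropyMDP.isBddMeas_linQ hφ h_bounded (θ (n + 1))) (fun n => rfl)
    (fun n p => by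
      rw [← EntropyMDP.qValue_eq, hθs n, ← EntropyMDP.linQ_sub]
      exact EntropyMDP.abs_linQ_le h_bounded _ p) hC
  obtain ⟨-, πo, -, hπo⟩ := M.exists_isOptimalPolicy
  refine ⟨a, ha, fun ρ hρ => ⟨⟨πo, hπo ρ hρ⟩, fun πs hπs n hn => ?_⟩⟩
  obtain ⟨v, hv, hsum⟩ := hreg ρ πs hπs
  have hn0 : (0 : ℝ) < n := by exact_mod_cast hn
  -- Some gap among the first `n` is at most the average `a / n`.
  obtain ⟨r, hr, hle⟩ := Finset.exists_le_of_sum_le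
    (f := fun r => ∫ s, M.realValue (π r) s ∂ρ - v) (g := fun _ => a / n)
    (Finset.nonempty_range_iff.2 (by omega)) ((hsum n).trans_eq (by
      rw [Finset.sum_const, Finset.card_range, nsmul_eq_mul, mul_div_cancel₀ _ hn0.ne']))
  refine (EReal.sub_le_sub (iInf_le _ (⟨r, Finset.mem_range.1 hr⟩ : Fin n)) le_rfl).trans ?_
  rw [hv, (hπ r).valueAt_eq ρ, ← EReal.coe_sub]
  exact EReal.coe_le_coe_iff.2 hle
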